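/- Consider an $M\times K$ fog radio access network ($M,K\ge 1$) with a library of $N$ files, independent and uniformly distributed on $\{0,1\}^L$, where $L$ is a multiple of $M$. User $k$ requests file $F_{d_k}$. In channel use $t$ the cloud sends $U(t)\in\mathbb C$ on a multicast fronthaul link and edge node (EN) $m$ receives $V_m(t)=G_mU(t)+W_m(t)$; EN $m$ sends $X_m(t)$ and user $k$ receives $Y_k(t)=\sum_{m=1}^M H_{k,m}X_m(t)+Z_k(t)$. The noises $W_m(t),Z_k(t)$ are i.i.d. $\mathcal{CN}(0,1)$; the gains $H_{k,m}$ are i.i.d. with an atomless law and constant in time, and the gains $G_m$ are fixed and nonzero; files, $H$ and noises are independent. The cloud knows $d,G,H$ and all files; $X_m(t)$ is a function of $d,G,H$, the cache of EN $m$ and $V_m(1),\dots,V_m(t-1)$; user $k$ decodes from $d_k,H,Y_k$. The delivery takes $T=T_F+T_E$ channel uses, a fronthaul phase of length $T_F$ (in which the ENs are silent) followed by an edge phase of length $T_E$ (in which the cloud is silent), both functions of $d,G,H$. The power constraints are $\frac1T\sum_{t\le T}|U(t)|^2\le P^r$ with $r>0$ and $\frac1T\sum_{t\le T}|X_m(t)|^2\le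 P$, and each EN stores at most $\mu NL$ bits. A family of policies (indexed by $L$ and $P$) is feasible if, for all $d$, $G$ and $P>1$, $\max_k\Pr(\hat F_{d_k}\ne F_{d_k})\to0$ as $L\to\infty$. A duration $\tau$ has normalized delivery time (NDT) $\lim_{P\to\infty}\lim_{L\to\infty}\frac{\tau}{L/\log_2P}$. Let $\mu=1/M$. Cut each file $F_i$ into $M$ disjoint parts $F_{i,1},\dots,F_{i,M}$ of $L/M$ bits, and let EN $j$ cache $F_{i,j}$ for all $i$. Then from its own parts and the XORs $F_{d_k,j}\oplus F_{d_k,j+1}$ ($1\le k\le K$, $1\le j\le M-1$) every EN can compute all requested files. Moreover, there is a feasible family of policies with this cache placement such that the cloud encodes only these XORs, every EN decodes them and recovers all requested files with error probability tending to $0$ as $L\to\infty$, the ENs then transmit the recovered files by zero-forcing beamforming, and, for every demand vector $d$, $$\delta_{F}=\frac{K(M-1)}{Mr},\qquad \delta_{E}=\frac{K}{\min\{M,K\}}.$$ Here $\delta_F$ and $\delta_E$ are the NDTs of $T_F$ and $T_E$ for almost every realization of $H$; $\delta_F$ is also the NDT of $\mathrm E_H[T_F]$, and $\delta_E$ is also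 the NDT of $\mathrm E_H[T_E]$ provided that $\mathrm E\big[1/\sum_{m=1}^M|H_{k,m}|^2\big]<\infty$. -/

import Mathlib

open MeasureTheory ProbabilityTheory Filter Topology
open scoped ENNReal NNReal

namespace FRAN

/-! ### Messages, channels, noise -/

/-- A file of `L` bits; addition in `ZMod 2` is the XOR of bits. -/
abbrev File (L : ℕ) : Type := Fin L → ZMod 2

/-- The popular set: `N` files of `L` bits. -/
abbrev Library (N L : ℕ) : Type := Fin N → File L

/-- A demand vector: user `k` requests file `d k`. -/
abbrev Demand (K N : ℕ) : Type := Fin K → Fin N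

/-- Fronthaul gains: `G m` is the gain from the cloud to edge node `m`. -/
abbrev FronthaulCSI (M : ℕ) : Type := Fin M → ℂ

/-- Edge gains: `H k m` is the gain from edge node `m` to user `k`. -/
abbrev EdgeCSI (M K : ℕ) : Type := Fin K → Fin M → ℂ

/-- Noise samples of `n` receivers in all channel uses. -/
abbrev Noise (n : ℕ) : Type := Fin n × ℕ → ℂ

/-- The circularly symmetric complex Gaussian law `CN(0,1)`: independent real and imaginary
parts, each of variance `1/2`. -/
noncomputable def complexGaussian : Measure ℂ :=
  ((gaussianReal 0 (1 / 2)).prod (gaussianReal 0 (1 / 2))).map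
    Complex.measurableEquivRealProd.symm

/-- I.i.d. `CN(0,1)` noise at `n` receivers. -/
noncomputable def noiseLaw (n : ℕ) : Measure (Noise n) :=
  Measure.infinitePi fun _ => complexGaussian

/-- I.i.d. edge gains with common law `ν`. -/
noncomputable def edgeLaw (M K : ℕ) (ν : Measure ℂ) : Measure (EdgeCSI M K) :=
  Measure.pi fun _ => Measure.pi fun _ => ν

/-- Joint law of the edge gains, the noise at the edge nodes and the noise at the users. -/
noncomputable def channelLaw (M K : ℕ) (ν : Measure ℂ) :
    Measure (EdgeCSI M K × Noise M × Noise K) :=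
  (edgeLaw M K ν).prod ((noiseLaw M).prod (noiseLaw K))

/-! ### Policies -/

/-- A joint caching / fronthaul / edge / decoding policy with `M` edge nodes, `K` users and `N`
files of `L` bits. Channel uses are numbered from `0`. -/
structure Policy (M K N L : ℕ) where
  /-- number of bits stored at each edge node -/
  cacheBits : ℕ
  /-- caching policy: content of the cache of edge node `m` -/
  cache : Fin M → Library N L → (Fin cacheBits → ZMod 2)
  /-- fronthaul transmission time, in channel uses -/
  TF : Demand K N → FronthaulCSI M → EdgeCSI M K → ℕ
  /-- edge transmission time, in channel uses -/
  TE : Demand K N → FronthaulCSI M → EdgeCSI M K → ℕ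
  /-- fronthaul policy: the signal `U(t)` sent by the cloud -/
  fronthaul : Demand K N → FronthaulCSI M → EdgeCSI M K → Library N L → ℕ → ℂ
  /-- edge policy: the signal `X_m(t)`, a function of the demands, the CSI, the cache of `m` and
  the fronthaul signal received by `m` in the channel uses before `t` -/
  edge : Fin M → Demand K N → FronthaulCSI M → EdgeCSI M K → (Fin cacheBits → ZMod 2) →
    (t : ℕ) → (Fin t → ℂ) → ℂ
  /-- decoding policy of user `k`, from its own demand, the edge CSI and the `T` received
  samples -/
  decode : Fin K → Fin N → EdgeCSI M K → (T : ℕ) → (Fin T → ℂ) → File L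

namespace Policy

variable {M K N L : ℕ} (π : Policy M K N L)

/-- Delivery latency: the fronthaul phase is followed by the edge phase. -/
def T (d : Demand K N) (G : FronthaulCSI M) (H : EdgeCSI M K) : ℕ :=
  π.TF d G H + π.TE d G H

/-- `V_m(t) = G_m U(t) + W_m(t)`. -/
noncomputable def recvEN (d : Demand K N) (G : FronthaulCSI M) (H : EdgeCSI M K)
    (F : Library N L) (W : Noise M) (m : Fin M) (t : ℕ) : ℂ :=
  G m * π.fronthaul d G H F t + W (m, t)

/-- `X_m(t)`. -/
noncomputable def edgeSignal (d : Demand K N) (G : FronthaulCSI M) (H : EdgeCSI M K)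
    (F : Library N L) (W : Noise M) (m : Fin M) (t : ℕ) : ℂ :=
  π.edge m d G H (π.cache m F) t fun s : Fin t => π.recvEN d G H F W m s

/-- `Y_k(t) = ∑ₘ H_{k,m} X_m(t) + Z_k(t)`. -/
noncomputable def recvUser (d : Demand K N) (G : FronthaulCSI M) (H : EdgeCSI M K)
    (F : Library N L) (W : Noise M) (Z : Noise K) (k : Fin K) (t : ℕ) : ℂ :=
  ∑ m, H k m * π.edgeSignal d G H F W m t + Z (k, t)

/-- The estimate by user `k` of the file that it requested. -/
noncomputable def estimate (d : Demand K N) (G : FronthaulCSI M) (H : EdgeCSI M K)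
    (F : Library N L) (W : Noise M) (Z : Noise K) (k : Fin K) : File L :=
  π.decode k (d k) H (π.T d G H) fun t : Fin (π.T d G H) => π.recvUser d G H F W Z k t

/-- Probability that user `k` decodes wrongly. The library is uniformly distributed and
independent of the gains `H` (i.i.d. with law `ν`) and of the noise. -/
noncomputable def userError (ν : Measure ℂ) (d : Demand K N) (G : FronthaulCSI M)
    (k : Fin K) : ℝ≥0∞ :=
  (∑ F : Library N L, channelLaw M K ν {ω | π.estimate d G ω.1 F ω.2.1 ω.2.2 k ≠ F (d k)}) /
    Fintype.card (Library N L)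

/-- Probability of error: the largest one among the users. -/
noncomputable def errorProb (ν : Measure ℂ) (d : Demand K N) (G : FronthaulCSI M) : ℝ≥0∞ :=
  ⨆ k, π.userError ν d G k

/-- All maps of the policy are measurable. -/
def IsMeasurable : Prop :=
  ∀ (d : Demand K N) (G : FronthaulCSI M),
    Measurable (π.TF d G) ∧ Measurable (π.TE d G) ∧
    (∀ F t, Measurable fun H => π.fronthaul d G H F t) ∧
    (∀ m S t, Measurable fun p : EdgeCSI M K × (Fin t → ℂ) => π.edge m d G p.1 S t p.2) ∧
    (∀ k n T f, MeasurableSet {p : EdgeCSI M K × (Fin T → ℂ) | π.decode k n p.1 T p.2 = f})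

/-- Each edge node stores at most `μ N L` bits. -/
def CacheConstraint (μ : ℝ) : Prop := (π.cacheBits : ℝ) ≤ μ * N * L

/-- Average power at most `P ^ r` at the cloud and at most `P` at every edge node, for every
realization. -/
def PowerConstraint (r P : ℝ) : Prop :=
  ∀ (d : Demand K N) (G : FronthaulCSI M) (H : EdgeCSI M K) (F : Library N L),
    (∑ t ∈ Finset.range (π.T d G H), ‖π.fronthaul d G H F t‖ ^ 2 ≤ π.T d G H * P ^ r) ∧
    ∀ (W : Noise M) (m : Fin M),
      ∑ t ∈ Finset.range (π.T d G H), ‖π.edgeSignal d G H F W m t‖ ^ 2 ≤ π.T d G H * P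

end Policy

/-! ### Normalized delivery time -/

/-- `lim_{P → ∞} lim_{L → ∞} τ / (L / log₂ P) = δ` for a duration `τ` that depends on `P` and on
the file size `L = M ℓ` (a multiple of `M`, since files are cut into `M` equal parts). -/
def HasNDT (M : ℕ) (τ : ℕ → ℝ → ℝ≥0∞) (δ : ℝ) : Prop :=
  ∃ g : ℝ → ℝ≥0∞,
    (∀ᶠ P : ℝ in atTop,
      Tendsto (fun ℓ : ℕ => τ ℓ P / ENNReal.ofReal (((M * ℓ : ℕ) : ℝ) / Real.logb 2 P))
        atTop (𝓝 (g P))) ∧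
    Tendsto g atTop (𝓝 (ENNReal.ofReal δ))

/-! ### Coded multicasting -/

/-- A file of `M ℓ` bits is cut into `M` disjoint parts of `ℓ` bits; this is part `j`. -/
def subfile {M ℓ : ℕ} (f : File (M * ℓ)) (j : Fin M) : File ℓ :=
  fun x => f (finProdFinEquiv (j, x))

/-- The type of the XORs sent by the cloud: `M - 1` blocks of `ℓ` bits for each user. -/
abbrev CodedMessage (M K ℓ : ℕ) : Type := Fin K → Fin (M - 1) → File ℓ

/-- The XORs `F_{i,j} ⊕ F_{i,j+1}`, `1 ≤ j ≤ M - 1`, for the files `i` requested by the users. -/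
def codedMessage {M K N ℓ : ℕ} (F : Library N (M * ℓ)) (d : Demand K N) : CodedMessage M K ℓ :=
  fun k j =>
    subfile (F (d k)) ⟨j, by omega⟩ + subfile (F (d k)) ⟨j + 1, by omega⟩

/-- Edge node `m` adds to its own part of a file the XORs between part `m` and part `j`, for all
`j`, and puts the results together. -/
def recoverFile {M ℓ : ℕ} (m : Fin M) (own : File ℓ) (c : Fin (M - 1) → File ℓ) :
    File (M * ℓ) :=
  fun b =>
    let j : Fin M := (finProdFinEquiv.symm b).1
    let x : Fin ℓ := (finProdFinEquiv.symm b).2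
    own x + ∑ i : Fin (M - 1),
      if min (m : ℕ) j ≤ i ∧ (i : ℕ) < max (m : ℕ) j then c i x else 0

/-- A coded multicasting scheme for files of `M ℓ` bits: the physical-layer encoders and decoders
that remain to be chosen. -/
structure CodedMulticast (M K N ℓ : ℕ) where
  /-- fronthaul transmission time -/
  TF : Demand K N → FronthaulCSI M → EdgeCSI M K → ℕ
  /-- edge transmission time -/
  TE : Demand K N → FronthaulCSI M → EdgeCSI M K → ℕ
  /-- channel code of the cloud for the XORs -/
  cloudEnc : Demand K N → FronthaulCSI M → EdgeCSI M K → CodedMessage M K ℓ → ℕ → ℂ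
  /-- decoder of the XORs at edge node `m`, from its `n` received samples -/
  enDec : Fin M → Demand K N → FronthaulCSI M → EdgeCSI M K → (n : ℕ) → (Fin n → ℂ) →
    CodedMessage M K ℓ
  /-- the symbol for user `k` in channel use `t` of the edge phase, as a function of the file
  requested by `k` -/
  symbol : Fin K → Demand K N → FronthaulCSI M → EdgeCSI M K → ℕ → File (M * ℓ) → ℂ
  /-- coefficient at edge node `m` of the symbol for user `k` in channel use `t` of the edge
  phase -/
  beam : Demand K N → FronthaulCSI M → EdgeCSI M K → ℕ → Fin M → Fin K → ℂ
  /-- decoder of user `k` -/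
  userDec : Fin K → Fin N → EdgeCSI M K → (T : ℕ) → (Fin T → ℂ) → File (M * ℓ)

namespace CodedMulticast

variable {M K N ℓ : ℕ} (σ : CodedMulticast M K N ℓ)

/-- The requested files as recovered by edge node `m` from its cache `S` and from the `n`
fronthaul samples `v`. -/
def recovered (m : Fin M) (d : Demand K N) (G : FronthaulCSI M) (H : EdgeCSI M K)
    (S : Fin (N * ℓ) → ZMod 2) (n : ℕ) (v : Fin n → ℂ) (k : Fin K) : File (M * ℓ) :=
  recoverFile m (fun x => S (finProdFinEquiv (d k, x))) (σ.enDec m d G H n v k)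

/-- The policy defined by a coded multicasting scheme. Edge node `m` caches part `m` of every
file. In the fronthaul phase the cloud sends the XORs; in the edge phase every edge node sends a
linear combination of the symbols of the requested files that it has recovered. -/
noncomputable def toPolicy : Policy M K N (M * ℓ) where
  cacheBits := N * ℓ
  cache m F := fun b => subfile (F (finProdFinEquiv.symm b).1) m (finProdFinEquiv.symm b).2
  TF := σ.TF
  TE := σ.TE
  fronthaul d G H F t := if t < σ.TF d G H then σ.cloudEnc d G H (codedMessage F d) t else 0
  edge m d G H S t v :=
    if h : σ.TF d G H ≤ t then
      ∑ k, σ.beam d G H (t - σ.TF d G H) m k *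
        σ.symbol k d G H (t - σ.TF d G H)
          (σ.recovered m d G H S (σ.TF d G H) (fun s => v (Fin.castLE h s)) k)
    else 0
  decode := σ.userDec

/-- Zero forcing: in each channel use of the edge phase, the symbol for one user is not received
by any other user that is being served (has a nonzero beam). -/
def IsZeroForcing : Prop :=
  ∀ (d : Demand K N) (G : FronthaulCSI M) (H : EdgeCSI M K), ∀ t < σ.TE d G H,
    ∀ k k' : Fin K, k ≠ k' → (∃ m, σ.beam d G H t m k' ≠ 0) →
      ∑ m, H k' m * σ.beam d G H t m k = 0

/-- Probability that some edge node fails to recover all requested files after the fronthaul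
phase. -/
noncomputable def enError (ν : Measure ℂ) (d : Demand K N) (G : FronthaulCSI M) : ℝ≥0∞ :=
  (∑ F : Library N (M * ℓ), channelLaw M K ν {ω | ∃ m k,
      σ.recovered m d G ω.1 (σ.toPolicy.cache m F) (σ.TF d G ω.1)
        (fun t => σ.toPolicy.recvEN d G ω.1 F ω.2.1 m t) k ≠ F (d k)}) /
    Fintype.card (Library N (M * ℓ))

end CodedMulticast

end FRAN

namespace FRAN

/-! ### Recovery of a file from its own part and the XORs -/

/-! In characteristic two the XORs of consecutive parts telescope, so one part and the XORs
determine the whole file (`recoverFile_eq`). What remains is to deliver `K (M - 1) ℓ` bits to every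
edge node at about `r log P` nats per channel use, and then `M ℓ` bits to each user at about `log P`
nats per channel use in which it is served.

Both hops use the same kind of code, with codewords made of points of a square grid and minimum
distance decoding. The pairwise error is at most `exp (-D / 4)`, with `D` the squared distance of
the received codewords (`noiseLaw_halfspace_le`). Averaging over all codebooks, some codebook has
average error at most the number of messages times `exp (-n * cutoffRate)` for length `n`
(`exists_gridCode`, `sum_noiseLaw_codeError_le`). With unit spacing and side `q` the cutoff rate is
`2 log q + O(1)`, so `q` close to `P ^ (r / 2)` gives rate `r log P` to first order. Dividing that
side by `1 + log P` leaves room for every constant factor in the power at large `P` and costs only a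
`log log P` term. Block lengths carry `√ℓ` extra bits: the error becomes `2 ^ (-√ℓ)`, and the
normalized length has the same limit.

In the edge phase `min M K` users are served at a time, in round-robin order, through the inverse of
a square channel matrix. It is almost surely invertible because the gains are atomless and a
determinant is affine in each entry (`ae_det_submatrix_ne_zero`). Beams are normalized so that the
received constellation depends on `H` only through a mode with countably many values. For a fixed
generic `H` zero forcing is used at all large `P`, whence `K / min M K`.

For expectations, a fixed `P` always has to handle gains for which zero forcing is too expensive.
Then one user at a time is served by a matched beam, with a smaller grid or, if the gains are very
weak, with two points per real dimension. The thresholds make `log P` over the rate at most `160 *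
(1 + sumInvGain H)` for all large `P`, uniformly in `H`
(`eventually_log_div_cutoffRate_edgeMode_le`), so dominated convergence applies to both limits. -/

lemma sum_Ico_add_succ_zmod_two (a : ℕ → ZMod 2) {m n : ℕ} (h : m ≤ n) :
    ∑ i ∈ Finset.Ico m n, (a i + a (i + 1)) = a m + a n := by
  induction n, h using Nat.le_induction with
  | base => simp [CharTwo.add_self_eq_zero]
  | succ n hmn ih =>
    rw [Finset.sum_Ico_succ_top hmn, ih]
    have := CharTwo.add_self_eq_zero (a n)
    linear_combination this

/-- The selected XORs form the telescoping sum between indices `m` and `j`, which leaves part `m`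
plus part `j`; adding part `m` cancels it. -/
lemma recoverFile_eq {M ℓ : ℕ} (f : File (M * ℓ)) (m : Fin M) (c : Fin (M - 1) → File ℓ)
    (hc : ∀ j : Fin (M - 1), c j =
      subfile f ⟨j, by omega⟩ + subfile f ⟨j + 1, by omega⟩) :
    recoverFile m (subfile f m) c = f := by
  funext b
  obtain ⟨⟨j, x⟩, rfl⟩ := finProdFinEquiv.surjective b
  simp only [recoverFile, Equiv.symm_apply_apply]
  -- Extension by zero only serves to index the parts by `ℕ`; all indices that contribute to the sum
  -- are below `M`.
  set a : ℕ → ZMod 2 := fun i => if h : i < M then subfile f ⟨i, h⟩ x else 0 with ha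
  have ham : ∀ i : Fin M, a i = subfile f i x := fun i => by simp [ha]
  have hsum : (∑ i : Fin (M - 1),
      if min (m : ℕ) j ≤ i ∧ (i : ℕ) < max (m : ℕ) j then c i x else 0)
      = ∑ i ∈ Finset.Ico (min (m : ℕ) j) (max (m : ℕ) j), (a i + a (i + 1)) := by
    have h1 : ∀ i : Fin (M - 1),
        (if min (m : ℕ) j ≤ i ∧ (i : ℕ) < max (m : ℕ) j then c i x else 0) =
        (fun i : ℕ => if min (m : ℕ) j ≤ i ∧ i < max (m : ℕ) j then a i + a (i + 1) else 0)
          (i : ℕ) := by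
      intro i
      have h2 : (i : ℕ) < M := by omega
      have h3 : (i : ℕ) + 1 < M := by omega
      simp [ha, hc, h2, h3]
    rw [Finset.sum_congr rfl fun i _ => h1 i,
      Fin.sum_univ_eq_sum_range (fun i : ℕ =>
        if min (m : ℕ) j ≤ i ∧ i < max (m : ℕ) j then a i + a (i + 1) else 0), ← Finset.sum_filter]
    refine Finset.sum_congr ?_ fun _ _ => rfl
    ext i
    simp only [Finset.mem_filter, Finset.mem_range, Finset.mem_Ico]
    have := m.2
    have := j.2
    omega
  rw [hsum, sum_Ico_add_succ_zmod_two a (by omega), ← ham m]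
  have hj : f (finProdFinEquiv (j, x)) = a j := by rw [ham j]; rfl
  rw [hj]
  rcases le_total (m : ℕ) j with h | h
  · rw [min_eq_left h, max_eq_right h]
    linear_combination CharTwo.add_self_eq_zero (a m)
  · rw [min_eq_right h, max_eq_left h]
    linear_combination CharTwo.add_self_eq_zero (a m)

/-! ### Random coding -/

/-- Pairwise independence of two codewords of a uniform codebook, as a count: two coordinates are
fixed and the others are free. -/
lemma card_filter_apply_eq_apply_eq {Msg X : Type*} [Fintype Msg] [DecidableEq Msg] [Fintype X]
    [DecidableEq X] {m m' : Msg} (h : m ≠ m') (x x' : X) :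
    (Finset.univ.filter fun c : Msg → X => c m = x ∧ c m' = x').card * Fintype.card X ^ 2
      = Fintype.card (Msg → X) := by
  have h1 : (Finset.univ.filter fun c : Msg → X => c m = x ∧ c m' = x') =
      Fintype.piFinset fun i => if i = m then {x} else if i = m' then {x'} else Finset.univ := by
    ext c
    simp only [Finset.mem_filter, Finset.mem_univ, true_and, Fintype.mem_piFinset]
    constructor
    · rintro ⟨rfl, rfl⟩ i
      split_ifs with h1 h2 <;> simp_all
    · intro hc
      have h1 := hc m
      have h2 := hc m'
      simp only [if_true, Finset.mem_singleton, if_neg h.symm] at h1 h2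
      exact ⟨h1, h2⟩
  rw [h1, Fintype.card_piFinset, Fintype.card_fun]
  rw [← Finset.mul_prod_erase _ _ (Finset.mem_univ m),
    ← Finset.mul_prod_erase _ _ (Finset.mem_erase.2 ⟨h.symm, Finset.mem_univ m'⟩)]
  have h2 : ∏ i ∈ (Finset.univ.erase m).erase m',
      (if i = m then ({x} : Finset X) else if i = m' then {x'} else Finset.univ).card
      = Fintype.card X ^ (Fintype.card Msg - 1 - 1) := by
    rw [Finset.prod_congr rfl (g := fun _ => Fintype.card X), Finset.prod_const,
      Finset.card_erase_of_mem (Finset.mem_erase.2 ⟨h.symm, Finset.mem_univ m'⟩),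
      Finset.card_erase_of_mem (Finset.mem_univ m), Finset.card_univ]
    intro i hi
    simp only [Finset.mem_erase, Finset.mem_univ, and_true] at hi
    simp [hi.1, hi.2]
  have h3 : 1 < Fintype.card Msg := Fintype.one_lt_card_iff.2 ⟨m, m', h⟩
  rw [h2]
  simp only [if_true, Finset.card_singleton, one_mul, if_neg h.symm]
  rw [← pow_add]
  congr 1
  omega

/-- The average of a function of two different codewords over all codebooks. -/
lemma sum_codebooks_pair {Msg X : Type*} [Fintype Msg] [DecidableEq Msg] [Fintype X]
    [DecidableEq X] {m m' : Msg} (h : m ≠ m') (f : X → X → ℝ) :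
    (∑ c : Msg → X, f (c m) (c m')) * (Fintype.card X : ℝ) ^ 2
      = Fintype.card (Msg → X) * ∑ x, ∑ x', f x x' := by
  have h1 : ∀ c : Msg → X, f (c m) (c m') =
      ∑ x, ∑ x', if c m = x ∧ c m' = x' then f x x' else 0 := by
    intro c
    rw [Finset.sum_eq_single (c m), Finset.sum_eq_single (c m')] <;> simp +contextual [eq_comm]
  simp_rw [h1]
  rw [Finset.sum_comm]
  simp_rw [Finset.sum_comm (s := (Finset.univ : Finset (Msg → X))), ← Finset.sum_filter,
    Finset.sum_const, nsmul_eq_mul, Finset.sum_mul, Finset.mul_sum]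
  refine Finset.sum_congr rfl fun x _ => Finset.sum_congr rfl fun x' _ => ?_
  have := card_filter_apply_eq_apply_eq h x x'
  rw [← this]
  push_cast
  ring

/-- Some codebook is at least as good as the average one. -/
lemma exists_codebook_le {I Msg X : Type*} [Fintype I] [Fintype Msg] [DecidableEq Msg]
    [Fintype X] [Nonempty X] (φ : I → Msg) (f : X → X → ℝ) (hf : ∀ x x', 0 ≤ f x x') :
    ∃ c : Msg → X, ∑ i, ∑ m' ∈ Finset.univ.erase (φ i), f (c (φ i)) (c m') ≤
      Fintype.card I * Fintype.card Msg * ((∑ x, ∑ x', f x x') / (Fintype.card X : ℝ) ^ 2) := by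
  classical
  by_contra! hcon
  have hX : (0 : ℝ) < Fintype.card X := by exact_mod_cast Fintype.card_pos
  set S : ℝ := (∑ x, ∑ x', f x x') / (Fintype.card X : ℝ) ^ 2 with hS
  have hS0 : 0 ≤ S := div_nonneg
    (Finset.sum_nonneg fun x _ => Finset.sum_nonneg fun x' _ => hf x x') (by positivity)
  have h1 : ∑ _c : Msg → X, (Fintype.card I * Fintype.card Msg * S : ℝ) <
      ∑ c : Msg → X, ∑ i, ∑ m' ∈ Finset.univ.erase (φ i), f (c (φ i)) (c m') :=
    Finset.sum_lt_sum_of_nonempty Finset.univ_nonempty fun c _ => hcon c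
  have h2 : ∀ m m' : Msg, m ≠ m' →
      ∑ c : Msg → X, f (c m) (c m') = Fintype.card (Msg → X) * S := by
    intro m m' h
    have := sum_codebooks_pair h f
    rw [hS]
    field_simp
    exact this
  rw [Finset.sum_comm] at h1
  have h3 : ∑ i, ∑ c : Msg → X, ∑ m' ∈ Finset.univ.erase (φ i), f (c (φ i)) (c m') ≤
      ∑ _i : I, (Fintype.card Msg * (Fintype.card (Msg → X) * S) : ℝ) := by
    refine Finset.sum_le_sum fun i _ => ?_
    rw [Finset.sum_comm]
    calc _ = ∑ m' ∈ Finset.univ.erase (φ i), (Fintype.card (Msg → X) * S : ℝ) := by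
          refine Finset.sum_congr rfl fun m' hm' => h2 _ _ ?_
          exact (Finset.ne_of_mem_erase hm').symm
      _ ≤ ∑ m' : Msg, (Fintype.card (Msg → X) * S : ℝ) := by
          refine Finset.sum_le_sum_of_subset_of_nonneg (Finset.erase_subset _ _) ?_
          intros; positivity
      _ = _ := by simp
  refine absurd (h1.trans_le h3) ?_
  simp only [Finset.sum_const, Finset.card_univ, nsmul_eq_mul, not_lt]
  apply le_of_eq
  ring

/-! ### Square constellations and their cutoff rate -/

/-- Average over a pair of points of a line constellation of `q + 1` points with spacing `1 / p`
of the Bhattacharyya factor. -/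
noncomputable def lineFactor (p q : ℕ) : ℝ :=
  (∑ u : Fin (q + 1), ∑ v : Fin (q + 1),
    Real.exp (-(((u : ℝ) - v) / p) ^ 2 / 4)) / (q + 1) ^ 2

/-- The cutoff rate, in nats per channel use, of the square constellation with `(q + 1) ^ 2` points
and spacing `1 / p`. -/
noncomputable def cutoffRate (p q : ℕ) : ℝ := -2 * Real.log (lineFactor p q)

/-- The points of the square constellation with unit spacing. -/
noncomputable def gridPoint {q : ℕ} (a : Fin (q + 1) × Fin (q + 1)) : ℂ := ⟨a.1, a.2⟩

lemma norm_gridPoint_sq_le {q : ℕ} (a : Fin (q + 1) × Fin (q + 1)) :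
    ‖gridPoint a‖ ^ 2 ≤ 2 * (q : ℝ) ^ 2 := by
  rw [Complex.sq_norm, Complex.normSq_apply]
  have h1 : ((a.1 : ℕ) : ℝ) ≤ q := by exact_mod_cast Nat.lt_succ_iff.1 a.1.2
  have h2 : ((a.2 : ℕ) : ℝ) ≤ q := by exact_mod_cast Nat.lt_succ_iff.1 a.2.2
  simp only [gridPoint]
  nlinarith [Nat.cast_nonneg (α := ℝ) (a.1 : ℕ), Nat.cast_nonneg (α := ℝ) (a.2 : ℕ)]

lemma lineFactor_pos (p q : ℕ) : 0 < lineFactor p q := by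
  unfold lineFactor
  have : 0 < ∑ u : Fin (q + 1), ∑ v : Fin (q + 1), Real.exp (-(((u : ℝ) - v) / p) ^ 2 / 4) :=
    Finset.sum_pos (fun u _ => Finset.sum_pos (fun v _ => Real.exp_pos _) Finset.univ_nonempty)
      Finset.univ_nonempty
  positivity

lemma exp_neg_cutoffRate (p q : ℕ) : Real.exp (-cutoffRate p q) = lineFactor p q ^ 2 := by
  rw [cutoffRate, ← Real.exp_log (pow_pos (lineFactor_pos p q) 2), Real.log_pow]
  simp

/-- Squared distance splits into real and imaginary parts, so the factor of the square grid is the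
square of that of the line; hence the 2 in `cutoffRate`. -/
lemma sum_grid_factor (p q : ℕ) :
    (∑ a : Fin (q + 1) × Fin (q + 1), ∑ b : Fin (q + 1) × Fin (q + 1),
      Real.exp (-‖gridPoint a - gridPoint b‖ ^ 2 / (4 * (p : ℝ) ^ 2))) =
      ((q : ℝ) + 1) ^ 4 * Real.exp (-cutoffRate p q) := by
  rw [exp_neg_cutoffRate, lineFactor]
  have h1 : ∀ a b : Fin (q + 1) × Fin (q + 1),
      Real.exp (-‖gridPoint a - gridPoint b‖ ^ 2 / (4 * (p : ℝ) ^ 2)) =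
      Real.exp (-(((a.1 : ℝ) - b.1) / p) ^ 2 / 4) *
        Real.exp (-(((a.2 : ℝ) - b.2) / p) ^ 2 / 4) := by
    intro a b
    rw [← Real.exp_add, Complex.sq_norm, Complex.normSq_apply]
    congr 1
    simp only [gridPoint, Complex.sub_re, Complex.sub_im]
    rcases eq_or_ne (p : ℝ) 0 with hp | hp
    · simp [hp]
    · field_simp
      ring
  have h2 : ∀ a : Fin (q + 1) × Fin (q + 1), ∑ b : Fin (q + 1) × Fin (q + 1),
      Real.exp (-‖gridPoint a - gridPoint b‖ ^ 2 / (4 * (p : ℝ) ^ 2)) =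
      (∑ v : Fin (q + 1), Real.exp (-(((a.1 : ℝ) - v) / p) ^ 2 / 4)) *
        ∑ v : Fin (q + 1), Real.exp (-(((a.2 : ℝ) - v) / p) ^ 2 / 4) := by
    intro a
    rw [Fintype.sum_mul_sum, Fintype.sum_prod_type]
    simp_rw [h1]
  simp_rw [h2]
  rw [Fintype.sum_prod_type]
  dsimp only
  rw [← Fintype.sum_mul_sum]
  field_simp

/-- Existence of a good codebook of points of the square constellation on the set `S` of channel
uses, for messages distributed as `φ i` for uniform `i`. -/
theorem exists_gridCode {I Msg : Type*} [Fintype I] [Fintype Msg] [DecidableEq Msg]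
    (φ : I → Msg) (S : Finset ℕ) (p q : ℕ) :
    ∃ x : Msg → ℕ → ℂ, (∀ m t, ‖x m t‖ ^ 2 ≤ 2 * (q : ℝ) ^ 2) ∧
      ∑ i, ∑ m' ∈ Finset.univ.erase (φ i),
        Real.exp (-(∑ t ∈ S, ‖x (φ i) t - x m' t‖ ^ 2) / (4 * (p : ℝ) ^ 2)) ≤
      Fintype.card I * (Fintype.card Msg * Real.exp (-cutoffRate p q * S.card)) := by
  classical
  obtain ⟨c, hc⟩ := exists_codebook_le (X := S → Fin (q + 1) × Fin (q + 1)) φ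
    (fun x x' => ∏ t, Real.exp (-‖gridPoint (x t) - gridPoint (x' t)‖ ^ 2 / (4 * (p : ℝ) ^ 2)))
    (fun x x' => Finset.prod_nonneg fun t _ => (Real.exp_pos _).le)
  refine ⟨fun m t => if h : t ∈ S then gridPoint (c m ⟨t, h⟩) else 0, fun m t => ?_, ?_⟩
  · dsimp only
    split_ifs
    · exact norm_gridPoint_sq_le _
    · simp
  · have h1 : ∀ m m', Real.exp (-(∑ t ∈ S, ‖(if h : t ∈ S then gridPoint (c m ⟨t, h⟩) else 0) -
        (if h : t ∈ S then gridPoint (c m' ⟨t, h⟩) else 0)‖ ^ 2) / (4 * (p : ℝ) ^ 2)) =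
        ∏ t : S, Real.exp (-‖gridPoint (c m t) - gridPoint (c m' t)‖ ^ 2 / (4 * (p : ℝ) ^ 2)) := by
      intro m m'
      rw [← Real.exp_sum, ← Finset.sum_div, Finset.sum_neg_distrib, ← Finset.sum_coe_sort S]
      congr 3
      refine Finset.sum_congr rfl fun t _ => ?_
      simp
    simp_rw [h1]
    refine hc.trans (le_of_eq ?_)
    rw [mul_assoc]
    congr 2
    -- The factor of a pair of words is a product over channel uses, so the sum over all pairs of
    -- words is a power of the sum over pairs of points.
    have h2 : ∀ x : S → Fin (q + 1) × Fin (q + 1),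
        ∑ x' : S → Fin (q + 1) × Fin (q + 1), ∏ t,
          Real.exp (-‖gridPoint (x t) - gridPoint (x' t)‖ ^ 2 / (4 * (p : ℝ) ^ 2)) =
        ∏ t, ∑ b : Fin (q + 1) × Fin (q + 1),
          Real.exp (-‖gridPoint (x t) - gridPoint b‖ ^ 2 / (4 * (p : ℝ) ^ 2)) := by
      intro x
      rw [Finset.prod_univ_sum, Fintype.piFinset_univ]
    have h3 : ∑ x : S → Fin (q + 1) × Fin (q + 1),
        ∏ t, ∑ b : Fin (q + 1) × Fin (q + 1),
          Real.exp (-‖gridPoint (x t) - gridPoint b‖ ^ 2 / (4 * (p : ℝ) ^ 2)) =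
        ∏ _t : S, ∑ a : Fin (q + 1) × Fin (q + 1), ∑ b : Fin (q + 1) × Fin (q + 1),
          Real.exp (-‖gridPoint a - gridPoint b‖ ^ 2 / (4 * (p : ℝ) ^ 2)) := by
      rw [Finset.prod_univ_sum, Fintype.piFinset_univ]
    simp_rw [h2, h3, sum_grid_factor]
    simp only [Finset.prod_const, Finset.card_univ, Fintype.card_coe, Fintype.card_fun,
      Fintype.card_prod, Fintype.card_fin]
    push_cast
    rw [mul_pow, mul_comm _ (S.card : ℝ), Real.exp_nat_mul, ← pow_mul, ← pow_mul,
      ← pow_two ((q : ℝ) + 1), ← pow_mul]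
    rw [show 2 * (S.card * 2) = 4 * S.card by ring]
    field_simp

/-! ### Bounds on the cutoff rate -/

/-- Split at `u` into two geometric series of ratio at most `4 / 5`, each of sum at most 5. -/
lemma sum_range_pow_dist_le (q u : ℕ) (hu : u ≤ q) {x : ℝ} (hx0 : 0 ≤ x) (hx1 : x ≤ 4 / 5) :
    ∑ v ∈ Finset.range (q + 1), x ^ (max u v - min u v) ≤ 10 := by
  have hgeom : ∀ n, ∑ i ∈ Finset.range n, x ^ i ≤ 5 := by
    intro n
    have h := geom_sum_mul_neg x n
    have h2 : 0 ≤ x ^ n := pow_nonneg hx0 n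
    have h3 : 0 ≤ ∑ i ∈ Finset.range n, x ^ i := Finset.sum_nonneg fun i _ => pow_nonneg hx0 i
    nlinarith
  have h1 : Finset.range (q + 1) = Finset.range u ∪ Finset.Ico u (q + 1) := by
    ext v; simp; omega
  rw [h1]
  refine (Finset.sum_union_inter (s₁ := Finset.range u) (s₂ := Finset.Ico u (q + 1))
    (f := fun v => x ^ (max u v - min u v)) ▸ le_add_of_nonneg_right
      (Finset.sum_nonneg fun i _ => pow_nonneg hx0 _)).trans ?_
  have h2 : ∑ v ∈ Finset.range u, x ^ (max u v - min u v) ≤ 5 := by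
    rw [← Finset.sum_range_reflect]
    refine le_trans (Finset.sum_le_sum fun v hv => ?_) (hgeom u)
    have hv' := Finset.mem_range.1 hv
    have h4 : max u (u - 1 - v) - min u (u - 1 - v) = v + 1 := by omega
    rw [h4, pow_succ]
    exact mul_le_of_le_one_right (pow_nonneg hx0 _) (by linarith)
  have h3 : ∑ v ∈ Finset.Ico u (q + 1), x ^ (max u v - min u v) ≤ 5 := by
    rw [Finset.sum_Ico_eq_sum_range]
    refine le_trans (le_of_eq (Finset.sum_congr rfl fun v _ => ?_)) (hgeom (q + 1 - u))
    congr 1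
    omega
  linarith

/-- For integers `n ≤ n ^ 2`, so the Gaussian factor at distance `n` is at most `x ^ n` with `x =
exp (-1 / 4) ≤ 4 / 5`; every row sum is then bounded independently of `q`. -/
lemma lineFactor_one_le (q : ℕ) : lineFactor 1 q ≤ 10 / (q + 1) := by
  have hx1 : Real.exp (-(1 / 4)) ≤ 4 / 5 := by
    rw [Real.exp_neg, inv_le_comm₀ (Real.exp_pos _) (by norm_num)]
    have := Real.add_one_le_exp (1 / 4 : ℝ)
    linarith
  have h : ∀ u : Fin (q + 1),
      ∑ v : Fin (q + 1), Real.exp (-(((u : ℝ) - v) / (1 : ℕ)) ^ 2 / 4) ≤ 10 := by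
    intro u
    refine le_trans ?_ (sum_range_pow_dist_le q u (Nat.lt_succ_iff.1 u.2) (Real.exp_pos _).le hx1)
    rw [← Fin.sum_univ_eq_sum_range
      (fun v => Real.exp (-(1 / 4)) ^ (max (u : ℕ) v - min (u : ℕ) v))]
    refine Finset.sum_le_sum fun v _ => ?_
    rw [← Real.exp_nat_mul]
    apply Real.exp_le_exp.2
    have h1 : (((u : ℝ) - v) / (1 : ℕ)) ^ 2 =
        ((max (u : ℕ) v - min (u : ℕ) v : ℕ) : ℝ) ^ 2 := by
      rcases le_total (u : ℕ) v with h | h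
      · rw [max_eq_right h, min_eq_left h, Nat.cast_sub h]; push_cast; ring
      · rw [max_eq_left h, min_eq_right h, Nat.cast_sub h]; push_cast; ring
    rw [h1]
    have h2 : ((max (u : ℕ) v - min (u : ℕ) v : ℕ) : ℝ) ≤
        ((max (u : ℕ) v - min (u : ℕ) v : ℕ) : ℝ) ^ 2 := by
      exact_mod_cast Nat.le_self_pow (by norm_num) _
    linarith
  unfold lineFactor
  rw [div_le_div_iff₀ (by positivity) (by positivity)]
  have h2 := Finset.sum_le_sum fun u (_ : u ∈ Finset.univ) => h u
  rw [Finset.sum_const, Finset.card_univ, Fintype.card_fin, nsmul_eq_mul] at h2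
  push_cast at h2 ⊢
  nlinarith [Nat.cast_nonneg (α := ℝ) q]

/-- The diagonal terms `u = v` alone give this. -/
lemma one_div_le_lineFactor (p q : ℕ) : 1 / ((q : ℝ) + 1) ≤ lineFactor p q := by
  unfold lineFactor
  rw [div_le_div_iff₀ (by positivity) (by positivity)]
  have h : ∀ u : Fin (q + 1),
      1 ≤ ∑ v : Fin (q + 1), Real.exp (-(((u : ℝ) - v) / p) ^ 2 / 4) := by
    intro u
    refine le_trans (by simp) (Finset.single_le_sum
      (f := fun v : Fin (q + 1) => Real.exp (-(((u : ℝ) - v) / p) ^ 2 / 4))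
      (fun v _ => (Real.exp_pos _).le) (Finset.mem_univ u))
  have h2 := Finset.sum_le_sum fun u (_ : u ∈ Finset.univ) => h u
  rw [Finset.sum_const, Finset.card_univ, Fintype.card_fin, nsmul_eq_mul] at h2
  push_cast at h2
  nlinarith [Nat.cast_nonneg (α := ℝ) q]

lemma cutoffRate_le (p q : ℕ) : cutoffRate p q ≤ 2 * Real.log (q + 1) := by
  have h := Real.log_le_log (by positivity) (one_div_le_lineFactor p q)
  rw [Real.log_div (by norm_num) (by positivity), Real.log_one] at h
  unfold cutoffRate
  linarith

lemma le_cutoffRate_one (q : ℕ) : 2 * Real.log ((q + 1) / 10) ≤ cutoffRate 1 q := by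
  have h := Real.log_le_log (lineFactor_pos 1 q) (lineFactor_one_le q)
  rw [← inv_div, Real.log_inv] at h
  unfold cutoffRate
  linarith

/-- A positive rate at every spacing, for the modes that must work however weak the gains are. With
`x = 1 / (4 p ^ 2)` the line factor is `(1 + exp (-x)) / 2 ≤ 1 - x / 4 ≤ exp (-x / 4)`. -/
lemma le_cutoffRate_two_points {p : ℕ} (hp : 1 ≤ p) : 1 / (8 * (p : ℝ) ^ 2) ≤ cutoffRate p 1 := by
  have hp' : (1 : ℝ) ≤ p := by exact_mod_cast hp
  set x : ℝ := 1 / (4 * (p : ℝ) ^ 2) with hx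
  have hx0 : 0 < x := by positivity
  have hx1 : x ≤ 1 := by
    rw [hx, div_le_one (by positivity)]
    nlinarith
  have h1 : lineFactor p 1 = (1 + Real.exp (-x)) / 2 := by
    have h2 : -((1 : ℝ) / p) ^ 2 / 4 = -x := by rw [hx]; field_simp
    have h3 : -((-1 : ℝ) / p) ^ 2 / 4 = -x := by rw [hx]; field_simp
    simp only [lineFactor, Nat.reduceAdd, Fin.sum_univ_two, Fin.val_zero, Fin.val_one]
    norm_num
    rw [h3, show -((p : ℝ) ^ 2)⁻¹ / 4 = -x by rw [← h2]; simp]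
    ring
  have h2 : Real.exp (-x) ≤ 1 - x / 2 := by
    have h3 : Real.exp (-x) ≤ 1 / (1 + x) := by
      rw [Real.exp_neg, one_div]
      exact inv_anti₀ (by linarith) (by linarith [Real.add_one_le_exp x])
    refine h3.trans ?_
    rw [div_le_iff₀ (by linarith)]
    nlinarith
  have h3 : lineFactor p 1 ≤ Real.exp (-(x / 4)) := by
    rw [h1]
    linarith [Real.add_one_le_exp (-(x / 4))]
  have h4 := Real.log_le_log (lineFactor_pos p 1) h3
  rw [Real.log_exp] at h4
  have h5 : 1 / (8 * (p : ℝ) ^ 2) = x / 2 := by rw [hx]; field_simp; norm_num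
  rw [h5, cutoffRate]
  linarith

end FRAN

namespace FRAN

/-! ### Gaussian noise -/

instance : IsProbabilityMeasure complexGaussian :=
  Measure.isProbabilityMeasure_map (by fun_prop)

instance (n : ℕ) : IsProbabilityMeasure (noiseLaw n) := by
  unfold noiseLaw; infer_instance

instance (M K : ℕ) (ν : Measure ℂ) [IsProbabilityMeasure ν] :
    IsProbabilityMeasure (edgeLaw M K ν) := by
  unfold edgeLaw; infer_instance

instance (M K : ℕ) (ν : Measure ℂ) [IsProbabilityMeasure ν] :
    IsProbabilityMeasure (channelLaw M K ν) := by
  unfold channelLaw; infer_instance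

/-- Real inner product of two complex numbers. -/
noncomputable def reInner (δ w : ℂ) : ℝ := δ.re * w.re + δ.im * w.im

lemma measurable_reInner (δ : ℂ) : Measurable (reInner δ) := by
  unfold reInner; fun_prop

lemma norm_add_sq_reInner (δ w : ℂ) : ‖δ + w‖ ^ 2 = ‖δ‖ ^ 2 + 2 * reInner δ w + ‖w‖ ^ 2 := by
  simp only [Complex.sq_norm, Complex.normSq_apply, reInner, Complex.add_re, Complex.add_im]
  ring

lemma integrable_exp_reInner_complexGaussian (δ : ℂ) (t : ℝ) :
    Integrable (fun w => Real.exp (t * reInner δ w)) complexGaussian := by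
  unfold complexGaussian
  rw [integrable_map_equiv]
  have h := (integrable_exp_mul_gaussianReal (μ := 0) (v := 1 / 2) (t * δ.re)).mul_prod
    (integrable_exp_mul_gaussianReal (μ := 0) (v := 1 / 2) (t * δ.im))
  refine h.congr (ae_of_all _ fun z => ?_)
  simp only [Function.comp, reInner, ← Real.exp_add]
  congr 1
  simp [Complex.measurableEquivRealProd]
  ring

/-- The inner product with `δ` is a centred real Gaussian of variance `‖δ‖ ^ 2 / 2`. -/
lemma mgf_reInner_complexGaussian (δ : ℂ) (t : ℝ) :
    mgf (reInner δ) complexGaussian t = Real.exp (t ^ 2 * ‖δ‖ ^ 2 / 4) := by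
  unfold mgf complexGaussian
  rw [integral_map_equiv]
  have h1 : ∀ z : ℝ × ℝ, Real.exp (t * reInner δ (Complex.measurableEquivRealProd.symm z)) =
      Real.exp ((t * δ.re) * z.1) * Real.exp ((t * δ.im) * z.2) := by
    intro z
    simp only [reInner, ← Real.exp_add]
    congr 1
    simp [Complex.measurableEquivRealProd]
    ring
  simp_rw [h1]
  rw [integral_prod_mul (fun x => Real.exp (t * δ.re * x)) (fun x => Real.exp (t * δ.im * x))]
  have h2 : ∀ s : ℝ, ∫ x, Real.exp (s * x) ∂(gaussianReal 0 (1 / 2)) = Real.exp (s ^ 2 / 4) := by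
    intro s
    have := congrFun (mgf_fun_id_gaussianReal (μ := 0) (v := 1 / 2)) s
    simp only [mgf] at this
    rw [this]
    congr 1
    push_cast
    ring
  rw [h2, h2, ← Real.exp_add, Complex.sq_norm, Complex.normSq_apply]
  congr 1
  ring

/-- Chernoff bound for a half-space under Gaussian noise. -/
lemma noiseLaw_halfspace_le {n : ℕ} (j : Fin n) (S : Finset ℕ) (τ : ℕ) (δ : ℕ → ℂ) :
    noiseLaw n {W | ∑ t ∈ S, ‖δ t + W (j, τ + t)‖ ^ 2 ≤ ∑ t ∈ S, ‖W (j, τ + t)‖ ^ 2} ≤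
      ENNReal.ofReal (Real.exp (-(∑ t ∈ S, ‖δ t‖ ^ 2) / 4)) := by
  set D : ℝ := ∑ t ∈ S, ‖δ t‖ ^ 2 with hD
  set X : ℕ → Noise n → ℝ := fun t W => reInner (δ t) (W (j, τ + t)) with hX
  have hXm : ∀ t, Measurable (X t) := fun t =>
    (measurable_reInner (δ t)).comp (measurable_pi_apply _)
  have hind : iIndepFun X (noiseLaw n) := by
    -- The shift `i.2 - τ` makes the coordinate `(j, τ + t)` carry the coefficient `δ t`.
    have h1 : iIndepFun (fun (i : Fin n × ℕ) (W : Noise n) => reInner (δ (i.2 - τ)) (W i))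
        (noiseLaw n) := iIndepFun_infinitePi (fun i => measurable_reInner _)
    have h2 := h1.precomp (g := fun t : ℕ => (j, τ + t)) (fun a b hab => by simpa using hab)
    simpa [hX] using h2
  have hmp : ∀ t, MeasurePreserving (Function.eval (j, τ + t)) (noiseLaw n) complexGaussian :=
    fun t => measurePreserving_eval_infinitePi _ _
  have hint : ∀ t ∈ S, Integrable (fun W => Real.exp (-1 * X t W)) (noiseLaw n) := fun t _ =>
    (hmp t).integrable_comp_of_integrable (integrable_exp_reInner_complexGaussian (δ t) (-1))
  have hmgf : ∀ t, mgf (X t) (noiseLaw n) (-1) = Real.exp (‖δ t‖ ^ 2 / 4) := by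
    intro t
    have h := mgf_reInner_complexGaussian (δ t) (-1)
    rw [← (hmp t).map_eq, mgf_map (hmp t).aemeasurable] at h
    · rw [show X t = reInner (δ t) ∘ Function.eval (j, τ + t) from rfl, h]
      norm_num
    · exact ((measurable_reInner (δ t)).const_mul _).exp.aestronglyMeasurable
  -- Expanding the squares cancels the noise energy and leaves a half-space in the noise.
  have hsub : {W : Noise n | ∑ t ∈ S, ‖δ t + W (j, τ + t)‖ ^ 2 ≤ ∑ t ∈ S, ‖W (j, τ + t)‖ ^ 2} ⊆
      {W | (∑ t ∈ S, X t) W ≤ -D / 2} := by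
    intro W hW
    simp only [Set.mem_ofPred_eq, norm_add_sq_reInner, Finset.sum_add_distrib,
      ← Finset.mul_sum] at hW
    simp only [Set.mem_ofPred_eq, Finset.sum_apply, hX]
    linarith
  refine (measure_mono hsub).trans ?_
  -- The parameter `-1` is the minimizer: the exponent is `-s D / 2 + s ^ 2 D / 4` at `-s`.
  have h := measure_le_le_exp_mul_mgf (μ := noiseLaw n) (X := ∑ t ∈ S, X t) (t := -1) (-D / 2)
    (by norm_num) (hind.integrable_exp_mul_sum hXm hint)
  rw [hind.mgf_sum hXm, Finset.prod_congr rfl fun t _ => hmgf t, ← Real.exp_sum,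
    ← Real.exp_add, ← Finset.sum_div, ← hD] at h
  rw [← ofReal_measureReal]
  refine ENNReal.ofReal_le_ofReal (h.trans (le_of_eq ?_))
  congr 1
  ring

/-! ### Minimum distance decoding -/

open Classical in
/-- Minimum distance decoder on the set `S` of channel uses for the codebook `X`: the message
whose codeword is strictly closer than all the others to `y`, if there is one. -/
noncomputable def minDistDecode {Msg : Type*} [Inhabited Msg] (S : Finset ℕ) (X : Msg → ℕ → ℂ)
    (y : ℕ → ℂ) : Msg :=
  if h : ∃ m, ∀ m', m' ≠ m → ∑ t ∈ S, ‖y t - X m t‖ ^ 2 < ∑ t ∈ S, ‖y t - X m' t‖ ^ 2 then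
    h.choose else default

variable {Msg : Type*}

lemma minDistDecode_eq [Inhabited Msg] {S : Finset ℕ} {X : Msg → ℕ → ℂ} {y : ℕ → ℂ} {m : Msg}
    (h : ∀ m', m' ≠ m → ∑ t ∈ S, ‖y t - X m t‖ ^ 2 < ∑ t ∈ S, ‖y t - X m' t‖ ^ 2) :
    minDistDecode S X y = m := by
  have hex : ∃ m, ∀ m', m' ≠ m → ∑ t ∈ S, ‖y t - X m t‖ ^ 2 < ∑ t ∈ S, ‖y t - X m' t‖ ^ 2 :=
    ⟨m, h⟩
  rw [minDistDecode, dif_pos hex]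
  by_contra hne
  exact lt_asymm (h _ hne) (hex.choose_spec m (Ne.symm hne))

/-- A strict winner is unique, so the choice in the decoder does no harm: the decoder is constant on
each winning region and equals the default off their union. -/
lemma measurableSet_minDistDecode_eq [Inhabited Msg] [Finite Msg] (S : Finset ℕ) (X : Msg → ℕ → ℂ) (m : Msg) :
    MeasurableSet {y : ℕ → ℂ | minDistDecode S X y = m} := by
  set A : Msg → Set (ℕ → ℂ) := fun m =>
    {y | ∀ m', m' ≠ m → ∑ t ∈ S, ‖y t - X m t‖ ^ 2 < ∑ t ∈ S, ‖y t - X m' t‖ ^ 2} with hA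
  have hAm : ∀ m, MeasurableSet (A m) := by
    intro m
    simp only [hA, Set.ofPred_forall]
    refine MeasurableSet.iInter fun m' => MeasurableSet.iInter fun _ => ?_
    exact measurableSet_lt (by fun_prop) (by fun_prop)
  have hU : MeasurableSet (⋃ m, A m) := MeasurableSet.iUnion hAm
  have heq : {y : ℕ → ℂ | minDistDecode S X y = m} =
      A m ∪ ((⋃ m, A m)ᶜ ∩ {_y | (default : Msg) = m}) := by
    ext y
    simp only [Set.mem_ofPred_eq, Set.mem_union, Set.mem_inter_iff, Set.mem_compl_iff,
      Set.mem_iUnion]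
    constructor
    · rintro rfl
      by_cases hex : ∃ m, y ∈ A m
      · left
        obtain ⟨m, hm⟩ := hex
        rw [minDistDecode_eq hm]
        exact hm
      · right
        refine ⟨hex, ?_⟩
        rw [minDistDecode, dif_neg]
        exact hex
    · rintro (h | ⟨h, rfl⟩)
      · exact minDistDecode_eq h
      · rw [minDistDecode, dif_neg]
        exact h
  rw [heq]
  exact (hAm m).union (hU.compl.inter (MeasurableSet.const _))

/-- Pairwise error event of receiver `j`, when the codewords differ by `δ` from the sent one. -/
def pairError {n : ℕ} (j : Fin n) (S : Finset ℕ) (τ : ℕ) (δ : ℕ → ℂ) : Set (Noise n) :=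
  {W | ∑ t ∈ S, ‖δ t + W (j, τ + t)‖ ^ 2 ≤ ∑ t ∈ S, ‖W (j, τ + t)‖ ^ 2}

/-- Union of the pairwise error events of receiver `j` for message `m`. -/
def codeError {n : ℕ} (j : Fin n) (S : Finset ℕ) (τ : ℕ) (X : Msg → ℕ → ℂ) (m : Msg) :
    Set (Noise n) :=
  ⋃ m' ∈ {m' | m' ≠ m}, pairError j S τ fun t => X m t - X m' t

/-- Ties belong to the error event, so outside it the sent message wins strictly. Samples outside
`S` play no role. -/
lemma minDistDecode_of_notMem_codeError [Inhabited Msg] {n : ℕ} {j : Fin n} {S : Finset ℕ} {τ : ℕ}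
    {X : Msg → ℕ → ℂ} {m : Msg} {W : Noise n} (hW : W ∉ codeError j S τ X m) {y : ℕ → ℂ}
    (hy : ∀ t ∈ S, y t = X m t + W (j, τ + t)) : minDistDecode S X y = m := by
  refine minDistDecode_eq fun m' hm' => ?_
  simp only [codeError, pairError, Set.mem_iUnion, Set.mem_ofPred_eq, not_exists, not_le] at hW
  refine lt_of_eq_of_lt (Finset.sum_congr rfl fun t ht => ?_)
    ((hW m' hm').trans_eq (Finset.sum_congr rfl fun t ht => ?_))
  · rw [hy t ht]; simp
  · rw [hy t ht]; congr 2; ring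

lemma measurableSet_codeError [Finite Msg] {n : ℕ} (j : Fin n) (S : Finset ℕ) (τ : ℕ)
    (X : Msg → ℕ → ℂ) (m : Msg) : MeasurableSet (codeError j S τ X m) := by
  refine MeasurableSet.iUnion fun m' => MeasurableSet.iUnion fun _ => ?_
  exact measurableSet_le (by fun_prop) (by fun_prop)

lemma noiseLaw_codeError_le [Fintype Msg] [DecidableEq Msg] {n : ℕ} (j : Fin n) (S : Finset ℕ)
    (τ : ℕ) (X : Msg → ℕ → ℂ) (m : Msg) :
    noiseLaw n (codeError j S τ X m) ≤ ENNReal.ofReal (∑ m' ∈ Finset.univ.erase m,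
      Real.exp (-(∑ t ∈ S, ‖X m t - X m' t‖ ^ 2) / 4)) := by
  rw [ENNReal.ofReal_sum_of_nonneg fun m' _ => (Real.exp_pos _).le]
  have h : codeError j S τ X m = ⋃ m' ∈ Finset.univ.erase m,
      pairError j S τ fun t => X m t - X m' t := by
    simp [codeError]
  rw [h]
  refine (measure_biUnion_finset_le _ _).trans (Finset.sum_le_sum fun m' _ => ?_)
  exact noiseLaw_halfspace_le j S τ _

end FRAN

namespace FRAN

/-! ### Generic invertibility of square submatrices -/

/-- Resampling one coordinate independently preserves a product law. It gives Fubini in one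
coordinate without splitting the dependent product. -/
lemma measurePreserving_update {ι : Type*} [Fintype ι] [DecidableEq ι] {α : ι → Type*}
    [∀ i, MeasurableSpace (α i)] (μ : ∀ i, Measure (α i)) [∀ i, IsProbabilityMeasure (μ i)]
    (k : ι) :
    MeasurePreserving (fun p : (∀ i, α i) × α k => Function.update p.1 k p.2)
      ((Measure.pi μ).prod (μ k)) (Measure.pi μ) := by
  have hmeas : Measurable fun p : (∀ i, α i) × α k => Function.update p.1 k p.2 := by
    refine measurable_pi_iff.2 fun i => ?_
    rcases eq_or_ne i k with rfl | h
    · simpa using measurable_snd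
    · simp only [Function.update_of_ne h]
      fun_prop
  refine ⟨hmeas, (Measure.pi_eq fun s hs => ?_).symm⟩
  rw [Measure.map_apply hmeas (MeasurableSet.univ_pi hs)]
  have h : (fun p : (∀ i, α i) × α k => Function.update p.1 k p.2) ⁻¹' Set.univ.pi s =
      (Set.univ.pi (Function.update s k Set.univ)) ×ˢ s k := by
    ext ⟨H, z⟩
    simp only [Set.mem_preimage, Set.mem_pi, Set.mem_univ, true_implies, Set.mem_prod]
    constructor
    · intro h
      refine ⟨fun i => ?_, by simpa using h k⟩
      rcases eq_or_ne i k with rfl | hi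
      · simp
      · simpa [hi] using h i
    · rintro ⟨h1, h2⟩ i
      rcases eq_or_ne i k with rfl | hi
      · simpa using h2
      · simpa [hi] using h1 i
  rw [h, Measure.prod_prod, Measure.pi_pi, ← Finset.mul_prod_erase _ _ (Finset.mem_univ k),
    ← Finset.mul_prod_erase Finset.univ (fun i => μ i (s i)) (Finset.mem_univ k)]
  rw [Function.update_self, measure_univ, one_mul, mul_comm]
  congr 1
  refine Finset.prod_congr rfl fun i hi => ?_
  rw [Function.update_of_ne (Finset.ne_of_mem_erase hi)]

lemma ae_pi_of_ae_update {ι : Type*} [Fintype ι] [DecidableEq ι] {α : ι → Type*}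
    [∀ i, MeasurableSpace (α i)] (μ : ∀ i, Measure (α i)) [∀ i, IsProbabilityMeasure (μ i)]
    (k : ι) {p : (∀ i, α i) → Prop} (hp : MeasurableSet {x | p x})
    (h : ∀ᵐ x ∂(Measure.pi μ), ∀ᵐ z ∂(μ k), p (Function.update x k z)) :
    ∀ᵐ x ∂(Measure.pi μ), p x := by
  have hm := measurePreserving_update μ k
  rw [← hm.map_eq, ae_map_iff hm.aemeasurable hp]
  exact (Measure.ae_prod_iff_ae_ae (hm.measurable hp)).2 h

variable {ν : Measure ℂ} [IsProbabilityMeasure ν]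

/-- With all entries but `h (c 0)` fixed, the sum vanishes for a single value of that entry, and `ν`
has no atoms. -/
lemma ae_sum_ne_zero (hν : ∀ z : ℂ, ν {z} = 0) {M s : ℕ} (c : Fin (s + 1) → Fin M)
    (hc : Function.Injective c) (a : Fin (s + 1) → ℂ) (ha : a 0 ≠ 0) :
    ∀ᵐ h ∂(Measure.pi fun _ : Fin M => ν), ∑ j, h (c j) * a j ≠ 0 := by
  refine ae_pi_of_ae_update _ (c 0) ?_ (ae_of_all _ fun h => ?_)
  · exact (measurableSet_eq_fun (by fun_prop) (by fun_prop)).compl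
  · have h1 : ∀ z, ∑ j, Function.update h (c 0) z (c j) * a j =
        z * a 0 + ∑ j : Fin s, h (c j.succ) * a j.succ := by
      intro z
      rw [Fin.sum_univ_succ, Function.update_self]
      congr 1
      refine Finset.sum_congr rfl fun j _ => ?_
      rw [Function.update_of_ne fun he => Fin.succ_ne_zero j (hc he)]
    have h2 : ∀ᵐ z ∂ν, z ≠ -(∑ j : Fin s, h (c j.succ) * a j.succ) / a 0 := by
      rw [ae_iff]
      simpa using hν _
    filter_upwards [h2] with z hz
    rw [h1]
    intro h0
    apply hz
    field_simp
    linear_combination h0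

/-- Induction on the size: expand along the first row and resample that row. The cofactor of its
first entry is a smaller minor of the other rows, almost surely nonzero, so `ae_sum_ne_zero`
applies. -/
theorem ae_det_submatrix_ne_zero (hν : ∀ z : ℂ, ν {z} = 0) {M K s : ℕ} (e : Fin s → Fin K)
    (he : Function.Injective e) (c : Fin s → Fin M) (hc : Function.Injective c) :
    ∀ᵐ H ∂(edgeLaw M K ν), (Matrix.of fun i j => H (e i) (c j)).det ≠ 0 := by
  induction s with
  | zero => simp
  | succ s ih =>
    have ih' := ih (e ∘ Fin.succ) (he.comp (Fin.succ_injective s)) (c ∘ Fin.succ)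
      (hc.comp (Fin.succ_injective s))
    refine ae_pi_of_ae_update _ (e 0) ?_ ?_
    · refine (measurableSet_eq_fun ?_ measurable_const).compl
      refine Continuous.measurable ?_
      fun_prop
    · filter_upwards [ih'] with H hH
      filter_upwards [ae_sum_ne_zero hν c hc (fun j => (-1) ^ (j : ℕ) *
        (Matrix.of fun i l : Fin s => H (e i.succ) (c (j.succAbove l))).det)
        (by simpa [Fin.succAbove_zero] using hH)] with h hh
      rw [Matrix.det_succ_row_zero]
      convert hh using 1
      refine Finset.sum_congr rfl fun j _ => ?_
      simp only [Matrix.of_apply, Function.update_self]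
      have h1 : (Matrix.of fun i j => Function.update H (e 0) h (e i) (c j)).submatrix
          Fin.succ j.succAbove = Matrix.of fun i l : Fin s => H (e i.succ) (c (j.succAbove l)) := by
        ext i l
        simp only [Matrix.submatrix_apply, Matrix.of_apply]
        rw [Function.update_of_ne fun h0 => Fin.succ_ne_zero i (he h0)]
      rw [h1]
      ring

lemma ae_row_ne_zero (hν : ∀ z : ℂ, ν {z} = 0) {M K : ℕ} (k : Fin K) (m : Fin M) :
    ∀ᵐ H ∂(edgeLaw M K ν), H k m ≠ 0 := by
  have h := ae_det_submatrix_ne_zero hν (fun _ : Fin 1 => k) (Function.injective_of_subsingleton _)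
    (fun _ : Fin 1 => m) (Function.injective_of_subsingleton _)
  simpa using h

end FRAN

namespace FRAN

/-! ### Codebooks and block lengths -/

open Classical in
/-- A good codebook of points of the square constellation, see `exists_gridCode`. -/
noncomputable def gridCode {I Msg : Type*} [Fintype I] [Fintype Msg] (φ : I → Msg)
    (S : Finset ℕ) (p q : ℕ) : Msg → ℕ → ℂ :=
  (exists_gridCode φ S p q).choose

section gridCode

variable {I Msg : Type*} [Fintype I] [Fintype Msg] (φ : I → Msg) (S : Finset ℕ) (p q : ℕ)

lemma norm_gridCode_le (m : Msg) (t : ℕ) : ‖gridCode φ S p q m t‖ ≤ √2 * q := by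
  classical
  have h := (exists_gridCode φ S p q).choose_spec.1 m t
  refine abs_le_of_sq_le_sq' ?_ (by positivity) |>.2
  rw [mul_pow, Real.sq_sqrt (by norm_num)]
  exact h

lemma sum_gridCode_le [DecidableEq Msg] :
    ∑ i, ∑ m' ∈ Finset.univ.erase (φ i),
        Real.exp (-(∑ t ∈ S, ‖gridCode φ S p q (φ i) t - gridCode φ S p q m' t‖ ^ 2) /
          (4 * (p : ℝ) ^ 2)) ≤
      Fintype.card I * (Fintype.card Msg * Real.exp (-cutoffRate p q * S.card)) := by
  unfold gridCode
  have h := (@exists_gridCode I Msg _ _ (Classical.decEq Msg) φ S p q).choose_spec.2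
  convert h

end gridCode

/-- Number of channel uses for `b` bits at rate `ρ` nats per channel use, with some slack. -/
noncomputable def blockLength (b ℓ : ℕ) (ρ : ℝ) : ℕ := ⌈(b + √ℓ) * Real.log 2 / ρ⌉₊

/-- The union bound over `2 ^ b` messages uses up `b` bits of the block; the extra `√ℓ` bits are the
error exponent. -/
lemma two_pow_mul_exp_blockLength_le (b ℓ : ℕ) {ρ : ℝ} (hρ : 0 < ρ) :
    2 ^ b * Real.exp (-ρ * blockLength b ℓ ρ) ≤ Real.exp (-(√ℓ * Real.log 2)) := by
  have h := Nat.le_ceil ((b + √ℓ) * Real.log 2 / ρ)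
  rw [div_le_iff₀ hρ] at h
  rw [← Real.exp_log (show (0 : ℝ) < 2 ^ b by positivity), Real.log_pow, ← Real.exp_add]
  apply Real.exp_le_exp.2
  unfold blockLength
  linarith

/-- Largest coordinate of the constellation used at power `P ^ r`. -/
noncomputable def gridSize (P r : ℝ) : ℕ := ⌊P ^ (r / 2) / (1 + Real.log P)⌋₊

/-! ### Fronthaul code -/

section Fronthaul

variable {M K N ℓ : ℕ}

/-- Upper bound on the inverse fronthaul gains. -/
noncomputable def invGain (G : FronthaulCSI M) : ℝ := ∑ m, ‖G m‖⁻¹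

/-- Inverse spacing and largest coordinate of the constellation of the cloud. -/
noncomputable def fronthaulMode (r P : ℝ) (G : FronthaulCSI M) : ℕ × ℕ :=
  if 10 ≤ gridSize P r ∧ √2 * invGain G * gridSize P r ≤ P ^ (r / 2) then (1, gridSize P r)
  -- Fallback for small `P`: the spacing is shrunk until a grid of side 1 meets the power
  -- constraint. The `+ 1` keeps the inverse spacing positive.
  else (⌈√2 * invGain G / P ^ (r / 2)⌉₊ + 1, 1)

/-- Length of the fronthaul phase. -/
noncomputable def fronthaulTime (K ℓ : ℕ) (r P : ℝ) (G : FronthaulCSI M) : ℕ :=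
  blockLength (K * ((M - 1) * ℓ)) ℓ
    (cutoffRate (fronthaulMode r P G).1 (fronthaulMode r P G).2)

/-- Codebook of the cloud. -/
noncomputable def cloudCode (r P : ℝ) (d : Demand K N) (G : FronthaulCSI M) :
    CodedMessage M K ℓ → ℕ → ℂ := fun c t =>
  ((invGain G / (fronthaulMode r P G).1 : ℝ) : ℂ) *
    gridCode (fun F : Library N (M * ℓ) => codedMessage F d)
      (Finset.range (fronthaulTime K ℓ r P G)) (fronthaulMode r P G).1 (fronthaulMode r P G).2 c t

lemma invGain_nonneg (G : FronthaulCSI M) : 0 ≤ invGain G :=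
  Finset.sum_nonneg fun _ _ => by positivity

lemma norm_cloudCode_le {r P : ℝ} (hP : 1 < P) (d : Demand K N) (G : FronthaulCSI M)
    (c : CodedMessage M K ℓ) (t : ℕ) : ‖cloudCode r P d G c t‖ ≤ P ^ (r / 2) := by
  have hP0 : 0 < P ^ (r / 2) := Real.rpow_pos_of_pos (by linarith) _
  have ha := invGain_nonneg G
  rw [cloudCode, norm_mul, Complex.norm_real, Real.norm_of_nonneg (by positivity)]
  refine (mul_le_mul_of_nonneg_left (norm_gridCode_le _ _ _ _ _ _) (by positivity)).trans ?_
  unfold fronthaulMode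
  split_ifs with h
  · simp only [Nat.cast_one, div_one]
    linarith [h.2]
  · have h1 := Nat.le_ceil (√2 * invGain G / P ^ (r / 2))
    rw [div_le_iff₀ hP0] at h1
    push_cast
    rw [div_mul_eq_mul_div, div_le_iff₀ (by positivity)]
    nlinarith

end Fronthaul

/-! ### Edge transmission -/

/-- Transmission mode of the edge phase: whether several users are served at a time, the inverse
spacing and the largest coordinate of the constellation. -/
abbrev EdgeMode : Type := Bool × ℕ × ℕ

section Edge

variable {M K N ℓ : ℕ}

/-- Number of users served at a time. -/
def numServed (M K : ℕ) (e : EdgeMode) : ℕ := if e.1 then min M K else 1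

/-- Position of user `k` in the round-robin order at time `t`. -/
def slot [NeZero K] (k : Fin K) (t : ℕ) : Fin K := k + Fin.ofNat K t

/-- The channel uses of the edge phase in which user `k` is served, for `n` rounds. -/
def servedTimes [NeZero K] (k : Fin K) (s n : ℕ) : Finset ℕ :=
  (Finset.range (K * n)).filter fun t => (slot k t : ℕ) < s

/-- In each round of `K` channel uses the slot of `k` takes every value once, so `k` is served
exactly `s` times. -/
lemma card_servedTimes [NeZero K] (k : Fin K) {s : ℕ} (hs : s ≤ K) (n : ℕ) :
    (servedTimes k s n).card = s * n := by
  unfold servedTimes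
  rw [Finset.card_filter]
  induction n with
  | zero => simp
  | succ n ih =>
    rw [mul_add_one, Finset.sum_range_add, ih, mul_add_one]
    congr 1
    have h1 : ∀ u : Fin K, (if (slot k (K * n + u) : ℕ) < s then 1 else 0) =
        (fun i : Fin K => if (i : ℕ) < s then 1 else 0) (Equiv.addLeft k u) := by
      intro u
      have : Fin.ofNat K (K * n + u) = u := by ext; simp [Fin.ofNat, Nat.mod_eq_of_lt u.2]
      simp only [slot, this, Equiv.coe_addLeft]
      rfl
    rw [← Fin.sum_univ_eq_sum_range (fun u => if (slot k (K * n + u) : ℕ) < s then 1 else 0),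
      Finset.sum_congr rfl fun u _ => h1 u,
      Equiv.sum_comp (Equiv.addLeft k) (fun i : Fin K => if (i : ℕ) < s then 1 else 0),
      Fin.sum_univ_eq_sum_range (fun i => if i < s then 1 else 0), ← Finset.card_filter]
    have : (Finset.range K).filter (fun i => i < s) = Finset.range s := by
      ext i; simp; omega
    rw [this, Finset.card_range]

/-- Number of rounds of the edge phase. -/
noncomputable def numRounds (M K ℓ : ℕ) (e : EdgeMode) : ℕ :=
  blockLength (M * ℓ) ℓ (numServed M K e * cutoffRate e.2.1 e.2.2)

/-- Codebook for file `i`, when it is sent to user `k`. -/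
noncomputable def userCode [NeZero K] (M N ℓ : ℕ) (e : EdgeMode) (i : Fin N) (k : Fin K) :
    File (M * ℓ) → ℕ → ℂ :=
  gridCode (fun F : Library N (M * ℓ) => F i)
    (servedTimes k (numServed M K e) (numRounds M K ℓ e)) e.2.1 e.2.2

/-- Gains from the first `min M K` edge nodes to the users served at a time. -/
def zfMatrix [NeZero K] (H : EdgeCSI M K) (τ : Fin K) :
    Matrix (Fin (min M K)) (Fin (min M K)) ℂ :=
  Matrix.of fun i j => H (Fin.castLE (min_le_right M K) i - τ) (Fin.castLE (min_le_left M K) j)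

/-- Total gain of user `k`. -/
noncomputable def userGain (H : EdgeCSI M K) (k : Fin K) : ℝ := ∑ m, ‖H k m‖ ^ 2

/-- Sum of the inverse gains of the users. -/
noncomputable def sumInvGain (H : EdgeCSI M K) : ℝ := ∑ k, (userGain H k)⁻¹

/-- Beams: zero forcing if several users are served at a time, and the matched beam if only one
user is served. -/
noncomputable def edgeBeam [NeZero K] (e : EdgeMode) (H : EdgeCSI M K) (t : ℕ) (m : Fin M)
    (k : Fin K) : ℂ :=
  if e.1 then
    if h : (m : ℕ) < min M K ∧ (slot k t : ℕ) < min M K then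
      (zfMatrix H (Fin.ofNat K t))⁻¹ ⟨m, h.1⟩ ⟨slot k t, h.2⟩ / e.2.1
    else 0
  else if slot k t = 0 then (starRingEnd ℂ) (H k m) / (userGain H k : ℂ) / e.2.1 else 0

/-- Zero forcing is used for these edge gains. -/
def UsesZF [NeZero K] (P : ℝ) (H : EdgeCSI M K) : Prop :=
  10 ≤ gridSize P 1 ∧ ∀ τ : Fin K, (zfMatrix H τ).det ≠ 0 ∧
    ∀ i j, K * ‖(zfMatrix H τ)⁻¹ i j‖ * (√2 * gridSize P 1) ≤ √P

open Classical in
/-- The transmission mode for the edge gains `H` at power `P`. -/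
noncomputable def edgeMode [NeZero K] (P : ℝ) (H : EdgeCSI M K) : EdgeMode :=
  if UsesZF P H then (true, 1, gridSize P 1)
  -- This intermediate mode keeps a rate of order `log P` when zero forcing is too expensive but the
  -- total gains are not weak. Going straight to a grid of side 1 would give a normalized time of
  -- order `log P` for such gains, with no bound uniform in `P`.
  else if 10 ≤ gridSize P (1 / 2) ∧ 2 * (gridSize P (1 / 2) : ℝ) ^ 2 * sumInvGain H ≤ P then
    (false, 1, gridSize P (1 / 2))
  else (false, ⌈√(2 * sumInvGain H / P)⌉₊ + 1, 1)

lemma edgeMode_spacing_pos [NeZero K] (P : ℝ) (H : EdgeCSI M K) : 1 ≤ (edgeMode P H).2.1 := by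
  unfold edgeMode
  split_ifs <;> simp

lemma userGain_nonneg (H : EdgeCSI M K) (k : Fin K) : 0 ≤ userGain H k :=
  Finset.sum_nonneg fun _ _ => by positivity

lemma sumInvGain_nonneg (H : EdgeCSI M K) : 0 ≤ sumInvGain H :=
  Finset.sum_nonneg fun k _ => inv_nonneg.2 (userGain_nonneg H k)

lemma norm_matched_le (H : EdgeCSI M K) (m : Fin M) (k : Fin K) :
    ‖(starRingEnd ℂ) (H k m) / (userGain H k : ℂ)‖ ≤ √(sumInvGain H) := by
  apply Real.le_sqrt_of_sq_le
  rw [norm_div, RCLike.norm_conj, Complex.norm_real, Real.norm_of_nonneg (userGain_nonneg H k)]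
  have h1 : (userGain H k)⁻¹ ≤ sumInvGain H :=
    Finset.single_le_sum (f := fun k => (userGain H k)⁻¹)
      (fun k _ => inv_nonneg.2 (userGain_nonneg H k)) (Finset.mem_univ k)
  refine le_trans ?_ h1
  have h2 : ‖H k m‖ ^ 2 ≤ userGain H k :=
    Finset.single_le_sum (f := fun m => ‖H k m‖ ^ 2) (fun m _ => by positivity)
      (Finset.mem_univ m)
  rcases (userGain_nonneg H k).eq_or_lt with h | h
  · simp [← h]
  · rw [div_pow, div_le_iff₀ (by positivity)]
    field_simp
    exact h2

/-- The linear combination sent by an edge node satisfies the power constraint. -/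
lemma norm_sum_edgeBeam_le [NeZero K] {P : ℝ} (hP : 1 < P) (H : EdgeCSI M K) (t : ℕ) (m : Fin M)
    (x : Fin K → ℂ) (hx : ∀ k, ‖x k‖ ≤ √2 * (edgeMode P H).2.2) :
    ‖∑ k, edgeBeam (edgeMode P H) H t m k * x k‖ ≤ √P := by
  have hG := sumInvGain_nonneg H
  refine (norm_sum_le _ _).trans ?_
  by_cases hzf : UsesZF P H
  · have he : edgeMode P H = (true, 1, gridSize P 1) := by simp [edgeMode, hzf]
    rw [he] at hx ⊢
    have hK : (0 : ℝ) < K := by exact_mod_cast NeZero.pos K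
    -- `UsesZF` lets each of the `K` summands use at most the amplitude `√P / K`.
    have h1 : ∀ k, ‖edgeBeam (true, 1, gridSize P 1) H t m k * x k‖ ≤ √P / K := by
      intro k
      rw [norm_mul, le_div_iff₀ hK]
      simp only [edgeBeam, if_true, Nat.cast_one, div_one]
      split_ifs with h
      · have h2 := (hzf.2 (Fin.ofNat K t)).2 ⟨m, h.1⟩ ⟨slot k t, h.2⟩
        refine le_trans ?_ h2
        have := mul_le_mul_of_nonneg_left (hx k)
          (norm_nonneg ((zfMatrix H (Fin.ofNat K t))⁻¹ ⟨m, h.1⟩ ⟨slot k t, h.2⟩))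
        nlinarith
      · simp
    refine (Finset.sum_le_sum fun k _ => h1 k).trans (le_of_eq ?_)
    simp
    field_simp
  -- Only the user in slot 0, namely `-t` modulo `K`, has a nonzero beam, and it may use the whole
  -- power.
  · have h1 : ∀ k, ‖edgeBeam (edgeMode P H) H t m k * x k‖ ≤
        if k = -Fin.ofNat K t then √P else 0 := by
      intro k
      have hfalse : (edgeMode P H).1 = false := by
        unfold edgeMode
        split_ifs <;> simp
      rw [edgeBeam, hfalse]
      simp only [Bool.false_eq_true, if_false, slot, ← eq_neg_iff_add_eq_zero]
      split_ifs with hk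
      · have h2 := mul_le_mul (norm_matched_le H m k) (hx k) (norm_nonneg _) (Real.sqrt_nonneg _)
        rw [norm_mul, norm_div, Complex.norm_natCast, div_mul_eq_mul_div,
          div_le_iff₀ (by exact_mod_cast edgeMode_spacing_pos P H)]
        refine h2.trans ?_
        unfold edgeMode
        rw [if_neg hzf]
        split_ifs with h3
        · simp only [Nat.cast_one, mul_one]
          apply Real.le_sqrt_of_sq_le
          rw [mul_pow, mul_pow, Real.sq_sqrt hG, Real.sq_sqrt (by norm_num)]
          linarith [h3.2]
        · have h4 := Nat.le_ceil √(2 * sumInvGain H / P)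
          rw [Real.sqrt_div (by positivity), Real.sqrt_mul (by norm_num),
            div_le_iff₀ (Real.sqrt_pos.2 (by linarith))] at h4
          rw [Real.sqrt_div (by positivity), Real.sqrt_mul (by norm_num)]
          push_cast
          nlinarith [Real.sqrt_nonneg P]
      · simp
    refine (Finset.sum_le_sum fun k _ => h1 k).trans (le_of_eq ?_)
    simp

/-- Under zero forcing only the first `min M K` edge nodes are active; this reduces the sum to the
square matrix. -/
lemma sum_mul_dite_lt {s M : ℕ} (h : s ≤ M) (f : Fin M → ℂ) (g : Fin s → ℂ) :
    ∑ m : Fin M, f m * (if hm : (m : ℕ) < s then g ⟨m, hm⟩ else 0) =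
      ∑ j : Fin s, f (Fin.castLE h j) * g j := by
  obtain ⟨c, rfl⟩ := Nat.exists_eq_add_of_le h
  rw [Fin.sum_univ_add]
  simp
  rfl

/-- What user `k'` receives of the beam of user `k` under zero forcing. -/
lemma sum_zf_beam [NeZero K] (H : EdgeCSI M K) (t p q : ℕ) (k k' : Fin K)
    (hk' : (slot k' t : ℕ) < min M K) (hdet : (zfMatrix H (Fin.ofNat K t)).det ≠ 0) :
    ∑ m, H k' m * edgeBeam (true, p, q) H t m k = if k = k' then 1 / (p : ℂ) else 0 := by
  simp only [edgeBeam, if_true]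
  by_cases hk : (slot k t : ℕ) < min M K
  · simp only [hk, and_true]
    have h1 := sum_mul_dite_lt (min_le_left M K) (H k')
      (fun j => (zfMatrix H (Fin.ofNat K t))⁻¹ j ⟨slot k t, hk⟩ / (p : ℂ))
    rw [h1]
    -- The gains of a served user are the row of `zfMatrix` at its slot, so the sum is an entry of
    -- the matrix times its inverse.
    have h2 : ∀ j, H k' (Fin.castLE (min_le_left M K) j) =
        zfMatrix H (Fin.ofNat K t) ⟨slot k' t, hk'⟩ j := by
      intro j
      simp [zfMatrix, slot]
    simp_rw [h2, ← mul_div_assoc]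
    rw [← Finset.sum_div, ← Matrix.mul_apply, Matrix.mul_nonsing_inv _ (isUnit_iff_ne_zero.2 hdet),
      Matrix.one_apply]
    have h3 : (⟨slot k' t, hk'⟩ : Fin (min M K)) = ⟨slot k t, hk⟩ ↔ k = k' := by
      rw [Fin.mk.injEq, Fin.val_inj, slot, slot, add_left_inj, eq_comm]
    simp only [h3]
    split_ifs <;> simp
  · have hne : k ≠ k' := by rintro rfl; exact hk hk'
    simp [hk, hne]

/-- Gain of the symbol of user `k` at user `k'`, when `k'` is served. -/
lemma sum_edgeBeam [NeZero K] {P : ℝ} (H : EdgeCSI M K) (hH : ∀ k, userGain H k ≠ 0) (t : ℕ)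
    (k k' : Fin K) (hk' : (slot k' t : ℕ) < numServed M K (edgeMode P H)) :
    ∑ m, H k' m * edgeBeam (edgeMode P H) H t m k =
      if k = k' then 1 / ((edgeMode P H).2.1 : ℂ) else 0 := by
  by_cases hzf : UsesZF P H
  · have he : edgeMode P H = (true, 1, gridSize P 1) := by simp [edgeMode, hzf]
    rw [he] at hk' ⊢
    exact sum_zf_beam H t _ _ k k' hk' (hzf.2 _).1
  · have hfalse : (edgeMode P H).1 = false := by
      unfold edgeMode
      split_ifs <;> simp
    rw [numServed, hfalse] at hk'
    simp only [Bool.false_eq_true, if_false, Nat.lt_one_iff, Fin.val_eq_zero_iff] at hk'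
    simp only [edgeBeam, hfalse, Bool.false_eq_true, if_false]
    have h1 : slot k t = 0 ↔ k = k' := by
      rw [← hk', slot, slot, add_left_inj]
    simp only [h1]
    split_ifs with h
    · subst h
      have h2 : ∀ m, H k m * ((starRingEnd ℂ) (H k m) / (userGain H k : ℂ) /
          ((edgeMode P H).2.1 : ℂ)) =
          ((‖H k m‖ ^ 2 : ℝ) : ℂ) * (1 / (userGain H k : ℂ) / ((edgeMode P H).2.1 : ℂ)) := by
        intro m
        have := Complex.mul_conj' (H k m)
        push_cast
        rw [← this]
        ring
      simp_rw [h2]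
      rw [← Finset.sum_mul, ← Complex.ofReal_sum, ← userGain]
      have : (userGain H k : ℂ) ≠ 0 := by exact_mod_cast hH k
      field_simp
    · simp

end Edge

end FRAN

namespace FRAN

/-! ### The scheme -/

section Scheme

variable {M K N ℓ : ℕ}

/-- Minimum distance decoding of the XORs at edge node `m`. -/
noncomputable def cloudDecode (r P : ℝ) (m : Fin M) (d : Demand K N) (G : FronthaulCSI M)
    (v : ℕ → ℂ) : CodedMessage M K ℓ :=
  minDistDecode (Finset.range (fronthaulTime K ℓ r P G))
    (fun c t => G m * cloudCode r P d G c t) v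

/-- Minimum distance decoding of file `i` at user `k`. -/
noncomputable def userDecode [NeZero K] (e : EdgeMode) (k : Fin K) (i : Fin N) (y : ℕ → ℂ) :
    File (M * ℓ) :=
  minDistDecode (servedTimes k (numServed M K e) (numRounds M K ℓ e))
    (fun f t => 1 / (e.2.1 : ℂ) * userCode M N ℓ e i k f t) y

/-- The received samples from channel use `a` on, continued by zero. -/
noncomputable def samplesFrom (a T : ℕ) (y : Fin T → ℂ) (t : ℕ) : ℂ :=
  if h : a + t < T then y ⟨a + t, h⟩ else 0

/-- The coded multicasting scheme. The users find the beginning of the edge phase from its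
length, which they can compute from `H`. -/
noncomputable def codedMulticastScheme [NeZero K] (M N : ℕ) (r : ℝ) (ℓ : ℕ) (P : ℝ) :
    CodedMulticast M K N ℓ where
  TF _ G _ := fronthaulTime K ℓ r P G
  TE _ _ H := K * numRounds M K ℓ (edgeMode P H)
  cloudEnc d G _ := cloudCode r P d G
  enDec m d G _ n v := cloudDecode r P m d G (samplesFrom 0 n v)
  symbol k d _ H t f := userCode M N ℓ (edgeMode P H) (d k) k f t
  beam _ _ H t m k := edgeBeam (edgeMode P H) H t m k
  userDec k i H T y :=
    userDecode (edgeMode P H) k i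
      (samplesFrom (T - K * numRounds M K ℓ (edgeMode P H)) T y)

lemma fronthaul_codedMulticastScheme [NeZero K] (r : ℝ) (P : ℝ) (d : Demand K N)
    (G : FronthaulCSI M) (H : EdgeCSI M K) (F : Library N (M * ℓ)) (t : ℕ) :
    (codedMulticastScheme (K := K) M N r ℓ P).toPolicy.fronthaul d G H F t =
      if t < fronthaulTime K ℓ r P G then cloudCode r P d G (codedMessage F d) t else 0 := rfl

/-- The requested file `k` as recovered by edge node `m` from its part and its samples. -/
noncomputable def recoveredFile (r P : ℝ) (m : Fin M) (d : Demand K N) (G : FronthaulCSI M)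
    (S : Fin (N * ℓ) → ZMod 2) (v : ℕ → ℂ) (k : Fin K) : File (M * ℓ) :=
  recoverFile m (fun x => S (finProdFinEquiv (d k, x))) (cloudDecode r P m d G v k)

lemma edge_codedMulticastScheme [NeZero K] (r : ℝ) (P : ℝ) (m : Fin M) (d : Demand K N)
    (G : FronthaulCSI M) (H : EdgeCSI M K)
    (S : Fin (codedMulticastScheme (K := K) M N r ℓ P).toPolicy.cacheBits → ZMod 2) (t : ℕ)
    (v : Fin t → ℂ) :
    (codedMulticastScheme (K := K) M N r ℓ P).toPolicy.edge m d G H S t v =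
      if h : fronthaulTime K ℓ r P G ≤ t then
        ∑ k, edgeBeam (edgeMode P H) H (t - fronthaulTime K ℓ r P G) m k *
          userCode M N ℓ (edgeMode P H) (d k) k
            (recoveredFile r P m d G S (samplesFrom 0 (fronthaulTime K ℓ r P G)
              fun s => v (Fin.castLE h s)) k) (t - fronthaulTime K ℓ r P G)
      else 0 := rfl

/-! ### Zero forcing, cache and power constraints -/

lemma exists_edgeBeam_ne_zero [NeZero K] {e : EdgeMode} {H : EdgeCSI M K} {t : ℕ} {k : Fin K}
    (h : ∃ m, edgeBeam e H t m k ≠ 0) : (slot k t : ℕ) < numServed M K e := by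
  obtain ⟨m, hm⟩ := h
  by_contra hk
  apply hm
  unfold edgeBeam
  unfold numServed at hk
  split_ifs at hk ⊢ with h1 h2 h2
  · exact absurd h2.2 hk
  · rfl
  · simp [h2] at hk
  · rfl

/-- This holds for every `H`, singular ones included: whenever zero forcing is not used, a single
user has a nonzero beam and the symbols of the others are not sent. -/
lemma isZeroForcing_codedMulticastScheme [NeZero K] (M N : ℕ) (r : ℝ) (ℓ : ℕ) (P : ℝ) :
    (codedMulticastScheme (K := K) M N r ℓ P).IsZeroForcing := by
  intro d G H t _ k k' hkk' hk'
  have hs := exists_edgeBeam_ne_zero hk'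
  change ∑ m, H k' m * edgeBeam (edgeMode P H) H t m k = 0
  by_cases hzf : UsesZF P H
  · have he : edgeMode P H = (true, 1, gridSize P 1) := by simp [edgeMode, hzf]
    rw [he] at hs ⊢
    rw [sum_zf_beam H t _ _ k k' hs (hzf.2 _).1, if_neg hkk']
  · have hfalse : (edgeMode P H).1 = false := by
      unfold edgeMode
      split_ifs <;> simp
    refine Finset.sum_eq_zero fun m _ => ?_
    rw [numServed, hfalse] at hs
    simp only [Bool.false_eq_true, if_false, Nat.lt_one_iff, Fin.val_eq_zero_iff] at hs
    have : slot k t ≠ 0 := by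
      rw [← hs]
      intro h
      exact hkk' (add_right_cancel h)
    simp [edgeBeam, hfalse, this]

lemma cacheConstraint_codedMulticastScheme [NeZero K] [NeZero M] (N : ℕ) (r : ℝ) (ℓ : ℕ)
    (P : ℝ) : (codedMulticastScheme (K := K) M N r ℓ P).toPolicy.CacheConstraint (1 / M) := by
  have hM : (M : ℝ) ≠ 0 := by exact_mod_cast NeZero.ne M
  simp only [Policy.CacheConstraint, CodedMulticast.toPolicy]
  push_cast
  apply le_of_eq
  field_simp

/-- Every single sample respects the bound, hence so does the average. -/
lemma powerConstraint_codedMulticastScheme [NeZero K] (M N : ℕ) (r : ℝ) (ℓ : ℕ) {P : ℝ}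
    (hP : 1 < P) : (codedMulticastScheme (K := K) M N r ℓ P).toPolicy.PowerConstraint r P := by
  intro d G H F
  constructor
  · have h1 : ∀ t, ‖(codedMulticastScheme (K := K) M N r ℓ P).toPolicy.fronthaul d G H F t‖ ^ 2 ≤
        P ^ r := by
      intro t
      rw [fronthaul_codedMulticastScheme]
      split_ifs with h
      · have h2 := norm_cloudCode_le (r := r) hP d G (codedMessage F d) t
        calc _ ≤ (P ^ (r / 2)) ^ 2 := by gcongr
          _ = P ^ r := by
            rw [← Real.rpow_natCast, ← Real.rpow_mul (by linarith)]
            norm_num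
      · simp only [norm_zero, ne_eq, OfNat.ofNat_ne_zero, not_false_eq_true, zero_pow]
        positivity
    refine (Finset.sum_le_sum fun t _ => h1 t).trans (le_of_eq ?_)
    simp
  · intro W m
    have h1 : ∀ t,
        ‖(codedMulticastScheme (K := K) M N r ℓ P).toPolicy.edgeSignal d G H F W m t‖ ^ 2 ≤ P := by
      intro t
      rw [Policy.edgeSignal, edge_codedMulticastScheme]
      split_ifs
      · calc _ ≤ (√P) ^ 2 := by
              gcongr
              exact norm_sum_edgeBeam_le hP H _ m _ fun k => norm_gridCode_le _ _ _ _ _ _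
          _ = P := Real.sq_sqrt (by linarith)
      · simp only [norm_zero, ne_eq, OfNat.ofNat_ne_zero, not_false_eq_true, zero_pow]
        linarith
    refine (Finset.sum_le_sum fun t _ => h1 t).trans (le_of_eq ?_)
    simp

/-! ### Measurability -/

/-- The inverse is the adjugate times the inverted determinant, which is measurable at singular
matrices too, with `0⁻¹ = 0`. -/
lemma measurable_zfMatrix_inv [NeZero K] (τ : Fin K) (i j : Fin (min M K)) :
    Measurable fun H : EdgeCSI M K => (zfMatrix H τ)⁻¹ i j := by
  simp only [Matrix.inv_def, Ring.inverse_eq_inv', Matrix.smul_apply, smul_eq_mul]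
  have hc : Continuous fun H : EdgeCSI M K => zfMatrix H τ := by
    refine continuous_matrix fun i j => ?_
    simp only [zfMatrix, Matrix.of_apply]
    fun_prop
  exact hc.matrix_det.measurable.inv.mul (hc.matrix_adjugate.matrix_elem i j).measurable

lemma measurableSet_usesZF [NeZero K] (P : ℝ) :
    MeasurableSet {H : EdgeCSI M K | UsesZF P H} := by
  have hc : ∀ τ, Continuous fun H : EdgeCSI M K => zfMatrix H τ := fun τ => by
    refine continuous_matrix fun i j => ?_
    simp only [zfMatrix, Matrix.of_apply]
    fun_prop
  simp only [UsesZF, Set.ofPred_and, Set.ofPred_forall]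
  refine (MeasurableSet.const _).inter (MeasurableSet.iInter fun τ => MeasurableSet.inter ?_ ?_)
  · exact (measurableSet_eq_fun (hc τ).matrix_det.measurable measurable_const).compl
  · refine MeasurableSet.iInter fun i => MeasurableSet.iInter fun j => ?_
    exact measurableSet_le (((measurable_zfMatrix_inv τ i j).norm.const_mul _).mul_const _)
      measurable_const

lemma measurable_userGain (k : Fin K) : Measurable fun H : EdgeCSI M K => userGain H k := by
  unfold userGain
  fun_prop

lemma measurable_sumInvGain : Measurable fun H : EdgeCSI M K => sumInvGain H := by
  unfold sumInvGain
  exact Finset.measurable_fun_sum _ fun k _ => (measurable_userGain k).inv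

lemma measurable_edgeMode [NeZero K] (P : ℝ) :
    Measurable fun H : EdgeCSI M K => edgeMode P H := by
  unfold edgeMode
  refine Measurable.ite (measurableSet_usesZF P) measurable_const
    (Measurable.ite ?_ measurable_const ?_)
  · rw [Set.ofPred_and]
    exact (MeasurableSet.const _).inter
      (measurableSet_le (measurable_sumInvGain.const_mul _) measurable_const)
  · refine measurable_const.prodMk (Measurable.prodMk ?_ measurable_const)
    exact (Nat.measurable_ceil.comp
      ((measurable_sumInvGain.const_mul _).div_const _).sqrt).add_const _

lemma measurable_edgeBeam [NeZero K] (e : EdgeMode) (t : ℕ) (m : Fin M) (k : Fin K) :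
    Measurable fun H : EdgeCSI M K => edgeBeam e H t m k := by
  unfold edgeBeam
  split_ifs with h1 h2 h2
  · exact (measurable_zfMatrix_inv _ _ _).div_const _
  · exact measurable_const
  · have h3 : Measurable fun H : EdgeCSI M K => (starRingEnd ℂ) (H k m) :=
      Complex.continuous_conj.measurable.comp (by fun_prop)
    exact (h3.div (Complex.measurable_ofReal.comp (measurable_userGain k))).div_const _
  · exact measurable_const

lemma measurable_samplesFrom (a T : ℕ) : Measurable (samplesFrom a T) := by
  refine measurable_pi_iff.2 fun t => ?_
  unfold samplesFrom
  split_ifs <;> fun_prop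

/-- Decoders and error events depend on `H` only through the mode, which has countably many values;
joint measurability then needs only each fixed mode. -/
lemma measurableSet_mem_of_countable {α β γ : Type*} [MeasurableSpace α] [MeasurableSpace β]
    [MeasurableSpace γ] [Countable γ] [MeasurableSingletonClass γ] {g : α → γ}
    (hg : Measurable g) {s : γ → Set β} (hs : ∀ c, MeasurableSet (s c)) :
    MeasurableSet {p : α × β | p.2 ∈ s (g p.1)} := by
  have : {p : α × β | p.2 ∈ s (g p.1)} = ⋃ c, (g ⁻¹' {c}) ×ˢ s c := by
    ext ⟨x, y⟩
    simp
  rw [this]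
  exact MeasurableSet.iUnion fun c => (hg (measurableSet_singleton c)).prod (hs c)

lemma measurable_cloudDecode (r P : ℝ) (m : Fin M) (d : Demand K N) (G : FronthaulCSI M) :
    Measurable (cloudDecode (ℓ := ℓ) r P m d G) :=
  measurable_to_countable' fun c => measurableSet_minDistDecode_eq _ _ c

lemma measurable_edgeSymbol [NeZero K] (r P : ℝ) (m : Fin M) (d : Demand K N)
    (G : FronthaulCSI M) (S : Fin (N * ℓ) → ZMod 2) (k : Fin K) (t : ℕ) :
    Measurable fun p : EdgeCSI M K × (ℕ → ℂ) =>
      userCode M N ℓ (edgeMode P p.1) (d k) k (recoveredFile r P m d G S p.2 k) t := by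
  have hg : Measurable fun q : EdgeMode × CodedMessage M K ℓ =>
      userCode M N ℓ q.1 (d k) k (recoverFile m (fun x => S (finProdFinEquiv (d k, x))) (q.2 k)) t :=
    measurable_of_countable _
  have h2 : Measurable fun p : EdgeCSI M K × (ℕ → ℂ) =>
      ((edgeMode P p.1, cloudDecode r P m d G p.2) : EdgeMode × CodedMessage M K ℓ) :=
    ((measurable_edgeMode P).comp measurable_fst).prodMk
      ((measurable_cloudDecode r P m d G).comp measurable_snd)
  have h := hg.comp h2
  unfold recoveredFile
  exact h

lemma isMeasurable_codedMulticastScheme [NeZero K] (M N : ℕ) (r : ℝ) (ℓ : ℕ) (P : ℝ) :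
    (codedMulticastScheme (K := K) M N r ℓ P).toPolicy.IsMeasurable := by
  intro d G
  refine ⟨measurable_const, ?_, fun F t => ?_, fun m S t => ?_,
    fun k i T f => ?_⟩
  · exact (measurable_of_countable fun e : EdgeMode => K * numRounds M K ℓ e).comp
      (measurable_edgeMode P)
  · simp only [fronthaul_codedMulticastScheme]
    exact measurable_const
  · simp only [edge_codedMulticastScheme]
    split_ifs with h
    · refine Finset.measurable_fun_sum _ fun k _ => Measurable.mul ?_ ?_
      · have h1 : Measurable fun q : EdgeCSI M K × EdgeMode =>
            edgeBeam q.2 q.1 (t - fronthaulTime K ℓ r P G) m k :=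
          measurable_from_prod_countable_left fun e => measurable_edgeBeam e _ m k
        exact h1.comp (measurable_fst.prodMk ((measurable_edgeMode P).comp measurable_fst))
      · have h2 : Measurable fun p : EdgeCSI M K × (Fin t → ℂ) =>
            samplesFrom 0 (fronthaulTime K ℓ r P G) fun s => p.2 (Fin.castLE h s) :=
          (measurable_samplesFrom _ _).comp (by fun_prop)
        have h3 := (measurable_edgeSymbol (N := N) (ℓ := ℓ) r P m d G S k
          (t - fronthaulTime K ℓ r P G)).comp (measurable_fst.prodMk h2)
        exact h3
    · exact measurable_const
  · exact measurableSet_mem_of_countable (measurable_edgeMode P) (s := fun e =>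
      {y | userDecode e k i (samplesFrom (T - K * numRounds M K ℓ e) T y) = f})
      fun e => measurable_samplesFrom _ _ (measurableSet_minDistDecode_eq _ _ f)

end Scheme

end FRAN

namespace FRAN

/-! ### Error probability -/

/-- Bound on the error probability of a code of length `blockLength b ℓ ρ`. -/
noncomputable def errorBound (ℓ : ℕ) : ℝ≥0∞ := ENNReal.ofReal (Real.exp (-(√ℓ * Real.log 2)))

lemma tendsto_errorBound : Tendsto errorBound atTop (𝓝 0) := by
  rw [← ENNReal.ofReal_zero]
  refine ENNReal.tendsto_ofReal (Real.tendsto_exp_neg_atTop_nhds_zero.comp ?_)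
  exact (Real.tendsto_sqrt_atTop.comp tendsto_natCast_atTop_atTop).atTop_mul_const
    (Real.log_pos (by norm_num))

/-- A single codebook serves every receiver at which distances are at least those of the grid with
spacing `1 / p`. Averaging over `i` rather than over messages matters for the XORs, which are not
uniform if demands repeat. -/
lemma sum_noiseLaw_codeError_le {I Msg : Type*} [Fintype I] [Fintype Msg] [DecidableEq Msg]
    (φ : I → Msg) (S : Finset ℕ) (p q : ℕ) {n : ℕ} (j : Fin n) (τ : ℕ) (X : Msg → ℕ → ℂ)
    (hX : ∀ m m' t, ‖gridCode φ S p q m t - gridCode φ S p q m' t‖ / p ≤ ‖X m t - X m' t‖) :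
    ∑ i, noiseLaw n (codeError j S τ X (φ i)) ≤ Fintype.card I *
      ENNReal.ofReal (Fintype.card Msg * Real.exp (-cutoffRate p q * S.card)) := by
  calc _ ≤ ∑ i, ENNReal.ofReal (∑ m' ∈ Finset.univ.erase (φ i),
        Real.exp (-(∑ t ∈ S, ‖gridCode φ S p q (φ i) t - gridCode φ S p q m' t‖ ^ 2) /
          (4 * (p : ℝ) ^ 2))) := by
        refine Finset.sum_le_sum fun i _ => (noiseLaw_codeError_le j S τ X (φ i)).trans ?_
        refine ENNReal.ofReal_le_ofReal (Finset.sum_le_sum fun m' _ => Real.exp_le_exp.2 ?_)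
        have h : ∑ t ∈ S, (‖gridCode φ S p q (φ i) t - gridCode φ S p q m' t‖ / p) ^ 2 ≤
            ∑ t ∈ S, ‖X (φ i) t - X m' t‖ ^ 2 :=
          Finset.sum_le_sum fun t _ => pow_le_pow_left₀ (by positivity) (hX _ _ t) 2
        simp_rw [div_pow] at h
        rw [← Finset.sum_div] at h
        rw [mul_comm, ← div_div, neg_div ((p : ℝ) ^ 2)]
        linarith
    _ = ENNReal.ofReal (∑ i, ∑ m' ∈ Finset.univ.erase (φ i),
        Real.exp (-(∑ t ∈ S, ‖gridCode φ S p q (φ i) t - gridCode φ S p q m' t‖ ^ 2) /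
          (4 * (p : ℝ) ^ 2))) :=
        (ENNReal.ofReal_sum_of_nonneg fun i _ =>
          Finset.sum_nonneg fun m' _ => (Real.exp_pos _).le).symm
    _ ≤ ENNReal.ofReal (Fintype.card I *
          (Fintype.card Msg * Real.exp (-cutoffRate p q * S.card))) :=
        ENNReal.ofReal_le_ofReal (sum_gridCode_le φ S p q)
    _ = _ := by rw [ENNReal.ofReal_mul (by positivity), ENNReal.ofReal_natCast]

lemma cutoffRate_pos_of_ten_le {q : ℕ} (hq : 10 ≤ q) : 0 < cutoffRate 1 q := by
  refine lt_of_lt_of_le ?_ (le_cutoffRate_one q)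
  have h : (10 : ℝ) ≤ q := by exact_mod_cast hq
  have : 0 < Real.log (((q : ℝ) + 1) / 10) := Real.log_pos (by linarith)
  linarith

lemma cutoffRate_two_points_pos (p : ℕ) : 0 < cutoffRate (p + 1) 1 :=
  lt_of_lt_of_le (by positivity) (le_cutoffRate_two_points (by omega))

variable {M K N ℓ : ℕ}

lemma cutoffRate_fronthaulMode_pos (r P : ℝ) (G : FronthaulCSI M) :
    0 < cutoffRate (fronthaulMode r P G).1 (fronthaulMode r P G).2 := by
  unfold fronthaulMode
  split_ifs with h
  · exact cutoffRate_pos_of_ten_le h.1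
  · exact cutoffRate_two_points_pos _

lemma cutoffRate_edgeMode_pos [NeZero K] (P : ℝ) (H : EdgeCSI M K) :
    0 < cutoffRate (edgeMode P H).2.1 (edgeMode P H).2.2 := by
  unfold edgeMode
  split_ifs with h h'
  · exact cutoffRate_pos_of_ten_le h.1
  · exact cutoffRate_pos_of_ten_le h'.1
  · exact cutoffRate_two_points_pos _

lemma one_le_norm_mul_invGain {G : FronthaulCSI M} {m : Fin M} (hG : G m ≠ 0) :
    1 ≤ ‖G m‖ * invGain G := by
  have h : ‖G m‖⁻¹ ≤ invGain G := Finset.single_le_sum (f := fun m => ‖G m‖⁻¹)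
    (fun m _ => by positivity) (Finset.mem_univ m)
  have h1 : 0 < ‖G m‖ := norm_pos_iff.2 hG
  calc 1 = ‖G m‖ * ‖G m‖⁻¹ := by field_simp
    _ ≤ _ := by gcongr

lemma card_file (L : ℕ) : Fintype.card (File L) = 2 ^ L := by
  simp [File]

lemma card_codedMessage (M K ℓ : ℕ) :
    Fintype.card (CodedMessage M K ℓ) = 2 ^ (K * ((M - 1) * ℓ)) := by
  simp only [CodedMessage, Fintype.card_fun, Fintype.card_fin, ZMod.card]
  rw [← pow_mul, ← pow_mul]
  congr 1
  ring

/-- Event that the decoder of edge node `m` may fail. -/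
def cloudError (r P : ℝ) (m : Fin M) (d : Demand K N) (G : FronthaulCSI M)
    (F : Library N (M * ℓ)) : Set (Noise M) :=
  codeError m (Finset.range (fronthaulTime K ℓ r P G)) 0
    (fun c t => G m * cloudCode r P d G c t) (codedMessage F d)

/-- The cloud scales its code by `invGain G`, which is at least every `‖G m‖⁻¹`, so no edge node
sees distances below those of the grid. -/
lemma sum_noiseLaw_cloudError_le (r P : ℝ) (m : Fin M) (d : Demand K N) {G : FronthaulCSI M}
    (hG : G m ≠ 0) : ∑ F : Library N (M * ℓ), noiseLaw M (cloudError r P m d G F) ≤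
      Fintype.card (Library N (M * ℓ)) * errorBound ℓ := by
  refine (sum_noiseLaw_codeError_le (fun F : Library N (M * ℓ) => codedMessage F d)
    (Finset.range (fronthaulTime K ℓ r P G)) (fronthaulMode r P G).1 (fronthaulMode r P G).2 m 0
    (fun c t => G m * cloudCode r P d G c t) fun c c' t => ?_).trans ?_
  · rw [← mul_sub, norm_mul, cloudCode, cloudCode, ← mul_sub, norm_mul, Complex.norm_real,
      Real.norm_of_nonneg (div_nonneg (invGain_nonneg G) (Nat.cast_nonneg _)), ← mul_assoc,
      ← mul_div_assoc, div_mul_eq_mul_div]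
    gcongr
    exact le_mul_of_one_le_left (norm_nonneg _) (one_le_norm_mul_invGain hG)
  · gcongr
    refine ENNReal.ofReal_le_ofReal ?_
    rw [card_codedMessage, Finset.card_range]
    push_cast
    exact two_pow_mul_exp_blockLength_le _ ℓ (cutoffRate_fronthaulMode_pos r P G)

lemma recoveredFile_eq (r P : ℝ) {m : Fin M} (d : Demand K N) (G : FronthaulCSI M)
    {F : Library N (M * ℓ)} {W : Noise M} (hW : W ∉ cloudError r P m d G F) {v : ℕ → ℂ}
    (hv : ∀ t < fronthaulTime K ℓ r P G,
      v t = G m * cloudCode r P d G (codedMessage F d) t + W (m, t))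
    {S : Fin (N * ℓ) → ZMod 2}
    (hS : ∀ i x, S (finProdFinEquiv (i, x)) = subfile (F i) m x) (k : Fin K) :
    recoveredFile r P m d G S v k = F (d k) := by
  have h : cloudDecode r P m d G v = codedMessage F d :=
    minDistDecode_of_notMem_codeError hW fun t ht => by
      rw [hv t (Finset.mem_range.1 ht), zero_add]
  rw [recoveredFile, h]
  simp_rw [hS]
  exact recoverFile_eq (F (d k)) m _ fun j => rfl

lemma samplesFrom_recvEN [NeZero K] (r P : ℝ) (m : Fin M) (d : Demand K N) (G : FronthaulCSI M)
    (H : EdgeCSI M K) (F : Library N (M * ℓ)) (W : Noise M) {t : ℕ}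
    (ht : t < fronthaulTime K ℓ r P G) :
    samplesFrom 0 (fronthaulTime K ℓ r P G)
      (fun s => (codedMulticastScheme (K := K) M N r ℓ P).toPolicy.recvEN d G H F W m s) t =
      G m * cloudCode r P d G (codedMessage F d) t + W (m, t) := by
  simp only [samplesFrom, zero_add, ht, dif_pos, Policy.recvEN, fronthaul_codedMulticastScheme,
    if_pos]

lemma cache_codedMulticastScheme [NeZero K] (r P : ℝ) (m : Fin M) (F : Library N (M * ℓ))
    (i : Fin N) (x : Fin ℓ) :
    (codedMulticastScheme (K := K) M N r ℓ P).toPolicy.cache m F (finProdFinEquiv (i, x)) =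
      subfile (F i) m x := by
  simp [CodedMulticast.toPolicy]

lemma recovered_codedMulticastScheme_eq [NeZero K] (r P : ℝ) {m : Fin M} (d : Demand K N)
    (G : FronthaulCSI M) (H : EdgeCSI M K) {F : Library N (M * ℓ)} {W : Noise M}
    (hW : W ∉ cloudError r P m d G F) (k : Fin K) :
    recoveredFile r P m d G ((codedMulticastScheme (K := K) M N r ℓ P).toPolicy.cache m F)
      (samplesFrom 0 (fronthaulTime K ℓ r P G)
        (fun s => (codedMulticastScheme (K := K) M N r ℓ P).toPolicy.recvEN d G H F W m s)) k =
      F (d k) :=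
  recoveredFile_eq r P d G hW (fun _ ht => samplesFrom_recvEN r P m d G H F W ht)
    (fun i x => cache_codedMulticastScheme r P m F i x) k

/-! ### Error probabilities under the law of gains and noise -/

variable (ν : Measure ℂ) [IsProbabilityMeasure ν]

lemma channelLaw_noiseEN (E : Set (Noise M)) (hE : MeasurableSet E) :
    channelLaw M K ν {ω | ω.2.1 ∈ E} = noiseLaw M E := by
  have h : MeasurePreserving (fun ω : EdgeCSI M K × Noise M × Noise K => ω.2.1)
      (channelLaw M K ν) (noiseLaw M) :=
    measurePreserving_fst.comp measurePreserving_snd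
  exact h.measure_preimage hE.nullMeasurableSet

lemma channelLaw_edgeCSI_noiseUser :
    MeasurePreserving (fun ω : EdgeCSI M K × Noise M × Noise K => (ω.1, ω.2.2))
      (channelLaw M K ν) ((edgeLaw M K ν).prod (noiseLaw K)) :=
  (MeasurePreserving.id _).prod measurePreserving_snd

lemma sum_channelLaw_cloudError_le [NeZero K] (r P : ℝ) (d : Demand K N) {G : FronthaulCSI M}
    (hG : ∀ m, G m ≠ 0) :
    ∑ F : Library N (M * ℓ), channelLaw M K ν {ω | ∃ m, ω.2.1 ∈ cloudError r P m d G F} ≤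
      Fintype.card (Library N (M * ℓ)) * (M * errorBound ℓ) := by
  calc _ ≤ ∑ F : Library N (M * ℓ), ∑ m, noiseLaw M (cloudError r P m d G F) := by
        refine Finset.sum_le_sum fun F _ => ?_
        rw [Set.ofPred_exists]
        refine (measure_iUnion_fintype_le _ _).trans (le_of_eq ?_)
        refine Finset.sum_congr rfl fun m _ => ?_
        exact channelLaw_noiseEN ν _ (measurableSet_codeError _ _ _ _ _)
    _ ≤ ∑ _m : Fin M, Fintype.card (Library N (M * ℓ)) * errorBound ℓ := by
        rw [Finset.sum_comm]
        exact Finset.sum_le_sum fun m _ => sum_noiseLaw_cloudError_le r P m d (hG m)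
    _ = _ := by simp; ring

lemma enError_codedMulticastScheme_le [NeZero K] (r P : ℝ) (d : Demand K N)
    {G : FronthaulCSI M} (hG : ∀ m, G m ≠ 0) :
    (codedMulticastScheme (K := K) M N r ℓ P).enError ν d G ≤ M * errorBound ℓ := by
  refine ENNReal.div_le_of_le_mul' ((Finset.sum_le_sum fun F _ => measure_mono ?_).trans
    (sum_channelLaw_cloudError_le ν r P d hG))
  rintro ω ⟨m, k, hne⟩
  by_contra hcon
  simp only [Set.mem_ofPred_eq, not_exists] at hcon
  exact hne (recovered_codedMulticastScheme_eq r P d G ω.1 (hcon m) k)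

/-- Event that the decoder of user `k` may fail on the Gaussian channel. -/
def userNoiseError [NeZero K] (a : ℕ) (e : EdgeMode) (i : Fin N) (k : Fin K) (f : File (M * ℓ)) :
    Set (Noise K) :=
  codeError k (servedTimes k (numServed M K e) (numRounds M K ℓ e)) a
    (fun f t => 1 / (e.2.1 : ℂ) * userCode M N ℓ e i k f t) f

lemma numServed_le [NeZero K] (e : EdgeMode) : numServed M K e ≤ K := by
  have := NeZero.pos K
  unfold numServed
  split_ifs <;> omega

lemma numServed_pos [NeZero M] [NeZero K] (e : EdgeMode) : 0 < numServed M K e := by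
  have := NeZero.pos K
  have := NeZero.pos M
  unfold numServed
  split_ifs <;> omega

/-- User `k` is served `numServed * numRounds` times, which is why `numRounds` is a block length at
rate `numServed * cutoffRate`. -/
lemma sum_noiseLaw_userNoiseError_le [NeZero M] [NeZero K] (a : ℕ) (P : ℝ) (H : EdgeCSI M K)
    (i : Fin N) (k : Fin K) :
    ∑ F : Library N (M * ℓ), noiseLaw K (userNoiseError a (edgeMode P H) i k (F i)) ≤
      Fintype.card (Library N (M * ℓ)) * errorBound ℓ := by
  set e := edgeMode P H with he
  refine (sum_noiseLaw_codeError_le (fun F : Library N (M * ℓ) => F i)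
    (servedTimes k (numServed M K e) (numRounds M K ℓ e)) e.2.1 e.2.2 k a
    (fun f t => 1 / (e.2.1 : ℂ) * userCode M N ℓ e i k f t) fun f f' t => ?_).trans ?_
  · rw [← mul_sub, norm_mul, norm_div, norm_one, Complex.norm_natCast, one_div_mul_eq_div]
    rfl
  · gcongr
    refine ENNReal.ofReal_le_ofReal ?_
    rw [card_file, card_servedTimes k (numServed_le e)]
    have h1 := two_pow_mul_exp_blockLength_le (M * ℓ) ℓ
      (mul_pos (show (0 : ℝ) < numServed M K e by exact_mod_cast numServed_pos e)
        (cutoffRate_edgeMode_pos P H))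
    refine le_trans (le_of_eq ?_) h1
    push_cast
    rw [numRounds]
    congr 2
    ring

/-- The bound for fixed `H` does not depend on `H`, so Fubini integrates it against the law of the
gains. -/
lemma sum_channelLaw_userNoiseError_le [NeZero M] [NeZero K] (a : ℕ) (P : ℝ) (i : Fin N)
    (k : Fin K) :
    ∑ F : Library N (M * ℓ), channelLaw M K ν
      {ω | ω.2.2 ∈ userNoiseError a (edgeMode P ω.1) i k (F i)} ≤
      Fintype.card (Library N (M * ℓ)) * errorBound ℓ := by
  have hE : ∀ F : Library N (M * ℓ), MeasurableSet
      {p : EdgeCSI M K × Noise K | p.2 ∈ userNoiseError a (edgeMode P p.1) i k (F i)} :=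
    fun F => measurableSet_mem_of_countable (measurable_edgeMode P)
      (s := fun e => userNoiseError a e i k (F i)) fun e => measurableSet_codeError _ _ _ _ _
  have h1 : ∀ F : Library N (M * ℓ), channelLaw M K ν
      {ω | ω.2.2 ∈ userNoiseError a (edgeMode P ω.1) i k (F i)} =
      ∫⁻ H, noiseLaw K (userNoiseError a (edgeMode P H) i k (F i)) ∂(edgeLaw M K ν) := by
    intro F
    have h2 := (channelLaw_edgeCSI_noiseUser ν).measure_preimage (hE F).nullMeasurableSet
    rw [Measure.prod_apply (hE F)] at h2
    exact h2
  simp_rw [h1]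
  rw [← lintegral_finsetSum]
  · refine (lintegral_mono fun H => sum_noiseLaw_userNoiseError_le a P H i k).trans ?_
    simp
  · intro F _
    exact measurable_measure_prodMk_left (hE F)

/-- If all edge nodes recover the files and the Gaussian channel of user `k` does not fail, then
the estimate of user `k` is correct. -/
lemma estimate_codedMulticastScheme_eq [NeZero K] (r P : ℝ) (d : Demand K N)
    (G : FronthaulCSI M) {H : EdgeCSI M K} (hH : ∀ k, userGain H k ≠ 0)
    {F : Library N (M * ℓ)} {W : Noise M} {Z : Noise K}
    (hW : ∀ m, W ∉ cloudError r P m d G F) {k : Fin K}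
    (hZ : Z ∉ userNoiseError (fronthaulTime K ℓ r P G) (edgeMode P H) (d k) k (F (d k))) :
    (codedMulticastScheme (K := K) M N r ℓ P).toPolicy.estimate d G H F W Z k = F (d k) := by
  set π := (codedMulticastScheme (K := K) M N r ℓ P).toPolicy with hπ
  set e := edgeMode P H with he
  have hT : π.T d G H = fronthaulTime K ℓ r P G + K * numRounds M K ℓ e := rfl
  have hedge : ∀ m t, π.edgeSignal d G H F W m (fronthaulTime K ℓ r P G + t) =
      ∑ k', edgeBeam e H t m k' * userCode M N ℓ e (d k') k' (F (d k')) t := by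
    intro m t
    rw [Policy.edgeSignal, edge_codedMulticastScheme, dif_pos (Nat.le_add_right _ _)]
    simp only [Nat.add_sub_cancel_left]
    refine Finset.sum_congr rfl fun k' _ => ?_
    congr 2
    exact recovered_codedMulticastScheme_eq r P d G H (hW m) k'
  change userDecode e k (d k) (samplesFrom (π.T d G H - K * numRounds M K ℓ e) (π.T d G H)
    fun t => π.recvUser d G H F W Z k t) = F (d k)
  refine minDistDecode_of_notMem_codeError hZ fun t ht => ?_
  obtain ⟨ht1, ht2⟩ := Finset.mem_filter.1 ht
  rw [Finset.mem_range] at ht1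
  have hlt : π.T d G H - K * numRounds M K ℓ e + t < π.T d G H := by omega
  -- The user does not know `G`; it finds the end of the fronthaul phase by subtracting the edge
  -- time, a function of `H`, from the total time.
  have hsub : π.T d G H - K * numRounds M K ℓ e = fronthaulTime K ℓ r P G := by omega
  rw [samplesFrom, dif_pos hlt]
  change π.recvUser d G H F W Z k (π.T d G H - K * numRounds M K ℓ e + t) = _
  rw [hsub, Policy.recvUser]
  congr 1
  simp_rw [hedge, Finset.mul_sum]
  rw [Finset.sum_comm]
  simp_rw [← mul_assoc]
  rw [Finset.sum_congr rfl fun k' _ => (Finset.sum_mul _ _ _).symm]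
  simp_rw [he, sum_edgeBeam H hH t _ k ht2]
  rw [Finset.sum_eq_single k]
  · simp
  · intro k' _ hk'
    simp [hk']
  · simp

lemma ae_userGain_ne_zero [NeZero M] (hν : ∀ z : ℂ, ν {z} = 0) :
    ∀ᵐ H ∂(edgeLaw M K ν), ∀ k, userGain H k ≠ 0 := by
  rw [ae_all_iff]
  intro k
  filter_upwards [ae_row_ne_zero hν k (0 : Fin M)] with H hH
  have h2 : ‖H k 0‖ ^ 2 ≤ userGain H k :=
    Finset.single_le_sum (f := fun m => ‖H k m‖ ^ 2) (fun m _ => by positivity)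
      (Finset.mem_univ 0)
  have : 0 < ‖H k 0‖ ^ 2 := by positivity
  linarith

lemma userError_codedMulticastScheme_le [NeZero M] [NeZero K] (hν : ∀ z : ℂ, ν {z} = 0)
    (r P : ℝ) (d : Demand K N) {G : FronthaulCSI M} (hG : ∀ m, G m ≠ 0) (k : Fin K) :
    (codedMulticastScheme (K := K) M N r ℓ P).toPolicy.userError ν d G k ≤
      M * errorBound ℓ + errorBound ℓ := by
  refine ENNReal.div_le_of_le_mul' ?_
  rw [mul_add]
  refine le_trans ?_ (add_le_add (sum_channelLaw_cloudError_le ν r P d hG)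
    (sum_channelLaw_userNoiseError_le ν (fronthaulTime K ℓ r P G) P (d k) k))
  rw [← Finset.sum_add_distrib]
  refine Finset.sum_le_sum fun F _ => le_trans (measure_mono_ae ?_) (measure_union_le _ _)
  -- The matched beam is useless for a user without gain, a null event; the inclusion of error
  -- events therefore holds only almost everywhere.
  have hae : ∀ᵐ ω ∂(channelLaw M K ν), ∀ k, userGain ω.1 k ≠ 0 :=
    (measurePreserving_fst (μ := edgeLaw M K ν)
      (ν := (noiseLaw M).prod (noiseLaw K))).quasiMeasurePreserving.ae (ae_userGain_ne_zero ν hν)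
  filter_upwards [hae] with ω hω hne
  by_contra hcon
  change ¬ ((∃ m, ω.2.1 ∈ cloudError r P m d G F) ∨
    ω.2.2 ∈ userNoiseError (fronthaulTime K ℓ r P G) (edgeMode P ω.1) (d k) k (F (d k))) at hcon
  rw [not_or, not_exists] at hcon
  exact hne (estimate_codedMulticastScheme_eq r P d G hω hcon.1 hcon.2)

lemma tendsto_enError [NeZero K] (r P : ℝ) (d : Demand K N) {G : FronthaulCSI M}
    (hG : ∀ m, G m ≠ 0) :
    Tendsto (fun ℓ => (codedMulticastScheme (K := K) M N r ℓ P).enError ν d G) atTop (𝓝 0) := by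
  refine tendsto_of_tendsto_of_tendsto_of_le_of_le tendsto_const_nhds ?_ (fun _ => zero_le)
    fun ℓ => enError_codedMulticastScheme_le ν r P d hG
  simpa using ENNReal.Tendsto.const_mul tendsto_errorBound (Or.inr (ENNReal.natCast_ne_top M))

lemma tendsto_errorProb [NeZero M] [NeZero K] (hν : ∀ z : ℂ, ν {z} = 0) (r P : ℝ)
    (d : Demand K N) {G : FronthaulCSI M} (hG : ∀ m, G m ≠ 0) :
    Tendsto (fun ℓ => (codedMulticastScheme (K := K) M N r ℓ P).toPolicy.errorProb ν d G)
      atTop (𝓝 0) := by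
  refine tendsto_of_tendsto_of_tendsto_of_le_of_le tendsto_const_nhds ?_ (fun _ => zero_le)
    fun ℓ => iSup_le fun k => userError_codedMulticastScheme_le ν hν r P d hG k
  simpa using (ENNReal.Tendsto.const_mul tendsto_errorBound
    (Or.inr (ENNReal.natCast_ne_top M))).add tendsto_errorBound

end FRAN

namespace FRAN

/-! ### Normalized delivery times -/

lemma le_blockLength (b ℓ : ℕ) (ρ : ℝ) : (b + √ℓ) * Real.log 2 / ρ ≤ blockLength b ℓ ρ :=
  Nat.le_ceil _

lemma blockLength_le (b ℓ : ℕ) {ρ : ℝ} (hρ : 0 < ρ) :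
    blockLength b ℓ ρ ≤ (b + √ℓ) * Real.log 2 / ρ + 1 := by
  have := Real.log_pos (show (1 : ℝ) < 2 by norm_num)
  exact (Nat.ceil_lt_add_one (by positivity)).le

/-- The slack and the rounding contribute `1 / √ℓ` and `1 / ℓ` after division by `ℓ`. -/
lemma tendsto_blockLength_div (B : ℕ) {ρ : ℝ} (hρ : 0 < ρ) :
    Tendsto (fun ℓ : ℕ => (blockLength (B * ℓ) ℓ ρ : ℝ) / ℓ) atTop (𝓝 (B * Real.log 2 / ρ)) := by
  have h1 : Tendsto (fun ℓ : ℕ => (√(ℓ : ℝ))⁻¹) atTop (𝓝 0) :=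
    (Real.tendsto_sqrt_atTop.comp tendsto_natCast_atTop_atTop).inv_tendsto_atTop
  have h2 : Tendsto (fun ℓ : ℕ => (ℓ : ℝ)⁻¹) atTop (𝓝 0) :=
    tendsto_natCast_atTop_atTop.inv_tendsto_atTop
  have hlow : Tendsto (fun ℓ : ℕ => (B + (√(ℓ : ℝ))⁻¹) * Real.log 2 / ρ) atTop
      (𝓝 (B * Real.log 2 / ρ)) := by
    simpa using ((h1.const_add (B : ℝ)).mul_const (Real.log 2)).div_const ρ
  have hup : Tendsto (fun ℓ : ℕ => (B + (√(ℓ : ℝ))⁻¹) * Real.log 2 / ρ + (ℓ : ℝ)⁻¹) atTop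
      (𝓝 (B * Real.log 2 / ρ)) := by
    simpa using hlow.add h2
  have hs : ∀ ℓ : ℕ, 1 ≤ ℓ → (((B * ℓ : ℕ) : ℝ) + √ℓ) * Real.log 2 / ρ / ℓ =
      (B + (√(ℓ : ℝ))⁻¹) * Real.log 2 / ρ := by
    intro ℓ hℓ
    have h0 : (0 : ℝ) < ℓ := by exact_mod_cast hℓ
    have h3 : √(ℓ : ℝ) / ℓ = (√(ℓ : ℝ))⁻¹ := by
      rw [Real.sqrt_div_self]
    rw [← h3]
    push_cast
    field_simp
  refine tendsto_of_tendsto_of_tendsto_of_le_of_le' hlow hup ?_ ?_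
  · filter_upwards [eventually_ge_atTop 1] with ℓ hℓ
    rw [← hs ℓ hℓ]
    gcongr
    exact le_blockLength _ _ _
  · filter_upwards [eventually_ge_atTop 1] with ℓ hℓ
    rw [← hs ℓ hℓ, ← one_div, ← add_div]
    gcongr
    exact blockLength_le _ _ hρ

lemma natCast_div_ofReal (n : ℕ) {x : ℝ} (hx : 0 < x) :
    (n : ℝ≥0∞) / ENNReal.ofReal x = ENNReal.ofReal (n / x) := by
  rw [ENNReal.ofReal_div_of_pos hx, ENNReal.ofReal_natCast]

/-- Normalized duration of `c` codewords for `B ℓ` bits each, for large `ℓ`. -/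
lemma tendsto_blockLength_normalized {M : ℕ} [NeZero M] (c B : ℕ) {ρ P : ℝ} (hρ : 0 < ρ)
    (hP : 1 < P) :
    Tendsto (fun ℓ : ℕ => ((c * blockLength (B * ℓ) ℓ ρ : ℕ) : ℝ≥0∞) /
      ENNReal.ofReal (((M * ℓ : ℕ) : ℝ) / Real.logb 2 P)) atTop
      (𝓝 (ENNReal.ofReal (c * B / M * (Real.log P / ρ)))) := by
  have hM : (0 : ℝ) < M := by exact_mod_cast NeZero.pos M
  have hlog : 0 < Real.log P := Real.log_pos hP
  have hlog2 : 0 < Real.log 2 := Real.log_pos (by norm_num)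
  have hlogb : 0 < Real.logb 2 P := Real.logb_pos (by norm_num) hP
  have h1 := ((tendsto_blockLength_div B hρ).const_mul (c : ℝ)).mul_const (Real.logb 2 P / M)
  have h2 : (c * (B * Real.log 2 / ρ) * (Real.logb 2 P / M)) =
      c * B / M * (Real.log P / ρ) := by
    rw [Real.logb]
    field_simp
  rw [h2] at h1
  refine (ENNReal.tendsto_ofReal h1).congr' ?_
  filter_upwards [eventually_ge_atTop 1] with ℓ hℓ
  have h0 : (0 : ℝ) < ℓ := by exact_mod_cast hℓ
  rw [natCast_div_ofReal _ (by push_cast; positivity)]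
  congr 1
  push_cast
  field_simp

/-- A bound uniform in `ℓ`, for dominated convergence: `√ℓ` and the rounding error 1 are both at
most `ℓ`. -/
lemma blockLength_normalized_le {M : ℕ} [NeZero M] (c B : ℕ) {ρ P : ℝ} (hρ : 0 < ρ)
    (hP : 1 < P) {ℓ : ℕ} (hℓ : 1 ≤ ℓ) :
    ((c * blockLength (B * ℓ) ℓ ρ : ℕ) : ℝ≥0∞) /
      ENNReal.ofReal (((M * ℓ : ℕ) : ℝ) / Real.logb 2 P) ≤
      ENNReal.ofReal (c / M * ((B + 1) * (Real.log P / ρ) + Real.logb 2 P)) := by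
  have hM : (0 : ℝ) < M := by exact_mod_cast NeZero.pos M
  have hlog : 0 < Real.log P := Real.log_pos hP
  have hlog2 : 0 < Real.log 2 := Real.log_pos (by norm_num)
  have hlogb : 0 < Real.logb 2 P := Real.logb_pos (by norm_num) hP
  have h1 : (1 : ℝ) ≤ ℓ := by exact_mod_cast hℓ
  have h0 : (0 : ℝ) < ℓ := by linarith
  rw [natCast_div_ofReal _ (by push_cast; positivity)]
  refine ENNReal.ofReal_le_ofReal ?_
  have h2 := blockLength_le (B * ℓ) ℓ hρ
  have h3 : √(ℓ : ℝ) ≤ ℓ := Real.sqrt_le_iff.2 ⟨h0.le, by nlinarith⟩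
  have h4 : (blockLength (B * ℓ) ℓ ρ : ℝ) ≤ ((B + 1) * Real.log 2 / ρ + 1) * ℓ := by
    refine h2.trans ?_
    push_cast
    have h5 : ((B : ℝ) * ℓ + √ℓ) * Real.log 2 / ρ ≤ ((B : ℝ) * ℓ + ℓ) * Real.log 2 / ρ := by
      gcongr
    refine (add_le_add h5 h1).trans (le_of_eq ?_)
    field_simp
  push_cast
  rw [div_le_iff₀ (by positivity)]
  have h6 : (c : ℝ) / M * ((B + 1) * (Real.log P / ρ) + Real.logb 2 P) *
      (M * ℓ / Real.logb 2 P) = c * (((B + 1) * Real.log 2 / ρ + 1) * ℓ) := by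
    rw [Real.logb]
    field_simp
  rw [h6]
  gcongr

/-! ### High power -/

lemma gridSize_le {P : ℝ} (hP : 1 < P) (r : ℝ) :
    (gridSize P r : ℝ) ≤ P ^ (r / 2) / (1 + Real.log P) := by
  have h := Real.log_pos hP
  have h2 : 0 < P ^ (r / 2) := Real.rpow_pos_of_pos (by linarith) _
  exact Nat.floor_le (by positivity)

lemma tendsto_log_one_add_log_div_log :
    Tendsto (fun P : ℝ => Real.log (1 + Real.log P) / Real.log P) atTop (𝓝 0) := by
  have h : Tendsto (fun x : ℝ => Real.log (1 + x) / x) atTop (𝓝 0) := by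
    have h1 : Tendsto (fun x : ℝ => Real.log (1 + x) / (1 + x)) atTop (𝓝 0) :=
      (Real.isLittleO_log_id_atTop.tendsto_div_nhds_zero).comp
        (tendsto_atTop_add_const_left _ 1 tendsto_id)
    have h2 : Tendsto (fun x : ℝ => x⁻¹ + 1) atTop (𝓝 (0 + 1)) :=
      tendsto_inv_atTop_zero.add_const 1
    have h3 := h1.mul h2
    rw [zero_mul] at h3
    refine h3.congr' ?_
    filter_upwards [eventually_gt_atTop 0] with x hx
    field_simp
  exact h.comp Real.tendsto_log_atTop

/-- The two bounds on the cutoff rate differ from `2 log (q + 1)` by a constant at most, and the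
factor `1 + log P` in `gridSize` changes `log q` only by `log (1 + log P) = o(log P)`. -/
lemma tendsto_cutoffRate_div_log {r : ℝ} (hr : 0 < r) :
    Tendsto (fun P : ℝ => cutoffRate 1 (gridSize P r) / Real.log P) atTop (𝓝 r) := by
  have hinv : Tendsto (fun P : ℝ => (Real.log P)⁻¹) atTop (𝓝 0) :=
    Real.tendsto_log_atTop.inv_tendsto_atTop
  have hlow : Tendsto (fun P : ℝ => r - 2 * (Real.log (1 + Real.log P) / Real.log P) -
      2 * Real.log 10 * (Real.log P)⁻¹) atTop (𝓝 r) := by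
    simpa using ((tendsto_log_one_add_log_div_log.const_mul 2).const_sub r).sub
      (hinv.const_mul (2 * Real.log 10))
  have hup : Tendsto (fun P : ℝ => r + 2 * Real.log 2 * (Real.log P)⁻¹) atTop (𝓝 r) := by
    simpa using (hinv.const_mul (2 * Real.log 2)).const_add r
  refine tendsto_of_tendsto_of_tendsto_of_le_of_le' hlow hup ?_ ?_
  · filter_upwards [eventually_gt_atTop 1] with P hP
    have hlog := Real.log_pos hP
    have hx : 0 < P ^ (r / 2) := Real.rpow_pos_of_pos (by linarith) _
    have h1 : P ^ (r / 2) / (1 + Real.log P) ≤ gridSize P r + 1 :=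
      (Nat.lt_floor_add_one _).le
    have h2 := Real.log_le_log (by positivity) (div_le_div_of_nonneg_right h1
      (show (0 : ℝ) ≤ 10 by norm_num))
    rw [Real.log_div (by positivity) (by norm_num), Real.log_div (by positivity) (by positivity),
      Real.log_rpow (by linarith)] at h2
    have h3 := le_cutoffRate_one (gridSize P r)
    rw [le_div_iff₀ hlog]
    field_simp
    linarith
  · filter_upwards [eventually_gt_atTop 1] with P hP
    have hlog := Real.log_pos hP
    have hx : 1 ≤ P ^ (r / 2) := Real.one_le_rpow hP.le (by linarith)
    have h1 : (gridSize P r : ℝ) ≤ P ^ (r / 2) :=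
      (gridSize_le hP r).trans (div_le_self (by linarith) (by linarith))
    have h2 := Real.log_le_log (show (0 : ℝ) < gridSize P r + 1 by positivity)
      (show (gridSize P r : ℝ) + 1 ≤ 2 * P ^ (r / 2) by linarith)
    rw [Real.log_mul (by norm_num) (by positivity), Real.log_rpow (by linarith)] at h2
    have h3 := cutoffRate_le 1 (gridSize P r)
    rw [div_le_iff₀ hlog]
    field_simp
    linarith

lemma tendsto_log_div_cutoffRate {r : ℝ} (hr : 0 < r) :
    Tendsto (fun P : ℝ => Real.log P / cutoffRate 1 (gridSize P r)) atTop (𝓝 (1 / r)) := by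
  simpa using (tendsto_cutoffRate_div_log hr).inv₀ hr.ne'

lemma eventually_le_gridSize {r : ℝ} (hr : 0 < r) (n : ℕ) :
    ∀ᶠ P : ℝ in atTop, n ≤ gridSize P r := by
  have h : Tendsto (fun P : ℝ => P ^ (r / 2) / (1 + Real.log P)) atTop atTop := by
    have h1 : (fun P : ℝ => 1 + Real.log P) =o[atTop] fun P => P ^ (r / 2) := by
      refine Asymptotics.IsLittleO.add ?_ (isLittleO_log_rpow_atTop (by positivity))
      exact (Asymptotics.isLittleO_const_left.2 (Or.inr
        (tendsto_norm_atTop_atTop.comp (tendsto_rpow_atTop (by positivity)))))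
    have h2 := h1.tendsto_div_nhds_zero
    have h3 : ∀ᶠ P : ℝ in atTop, 0 < (1 + Real.log P) / P ^ (r / 2) := by
      filter_upwards [eventually_gt_atTop 1] with P hP
      have := Real.log_pos hP
      have : 0 < P ^ (r / 2) := Real.rpow_pos_of_pos (by linarith) _
      positivity
    have h4 := (tendsto_nhdsWithin_iff.2 ⟨h2, h3⟩).inv_tendsto_nhdsGT_zero
    refine h4.congr fun P => ?_
    simp
  exact (tendsto_nat_floor_atTop.comp h).eventually_ge_atTop n

/-- The purpose of the factor `1 + log P` in `gridSize`: it exceeds any constant `c` eventually. -/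
lemma eventually_mul_gridSize_le (r c : ℝ) :
    ∀ᶠ P : ℝ in atTop, c * gridSize P r ≤ P ^ (r / 2) := by
  filter_upwards [eventually_gt_atTop 1, Real.tendsto_log_atTop.eventually_ge_atTop c] with P hP hc
  have hlog := Real.log_pos hP
  have h := gridSize_le hP r
  rw [le_div_iff₀ (by linarith)] at h
  nlinarith [Nat.cast_nonneg (α := ℝ) (gridSize P r)]

/-! ### Transmission modes at high power -/

variable {M K N : ℕ}

lemma eventually_fronthaulMode_eq {r : ℝ} (hr : 0 < r) (G : FronthaulCSI M) :
    ∀ᶠ P : ℝ in atTop, fronthaulMode r P G = (1, gridSize P r) := by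
  filter_upwards [eventually_le_gridSize hr 10, eventually_mul_gridSize_le r (√2 * invGain G)]
    with P h1 h2
  rw [fronthaulMode, if_pos ⟨h1, h2⟩]

/-- For fixed `H` only finitely many entries of inverses have to be absorbed by the power. -/
lemma eventually_edgeMode_eq [NeZero K] {H : EdgeCSI M K}
    (hH : ∀ τ : Fin K, (zfMatrix H τ).det ≠ 0) :
    ∀ᶠ P : ℝ in atTop, edgeMode P H = (true, 1, gridSize P 1) := by
  have h1 : ∀ᶠ P : ℝ in atTop, ∀ τ : Fin K, ∀ i j,
      (K * ‖(zfMatrix H τ)⁻¹ i j‖ * √2) * gridSize P 1 ≤ P ^ ((1 : ℝ) / 2) := by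
    simp only [eventually_all]
    exact fun τ i j => eventually_mul_gridSize_le 1 _
  filter_upwards [eventually_le_gridSize one_pos 10, h1] with P h2 h3
  rw [edgeMode, if_pos]
  refine ⟨h2, fun τ => ⟨hH τ, fun i j => ?_⟩⟩
  rw [Real.sqrt_eq_rpow P, ← mul_assoc]
  exact h3 τ i j

lemma ae_det_zfMatrix_ne_zero [NeZero K] {ν : Measure ℂ} [IsProbabilityMeasure ν]
    (hν : ∀ z : ℂ, ν {z} = 0) :
    ∀ᵐ H ∂(edgeLaw M K ν), ∀ τ : Fin K, (zfMatrix H τ).det ≠ 0 := by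
  rw [ae_all_iff]
  intro τ
  exact ae_det_submatrix_ne_zero hν (fun i => Fin.castLE (min_le_right M K) i - τ)
    (fun i j h => Fin.castLE_injective _ (sub_left_injective h))
    (Fin.castLE (min_le_left M K)) (Fin.castLE_injective _)

/-- Uniform bound on the normalized transmission time per user. -/
lemma eventually_log_div_cutoffRate_edgeMode_le [NeZero K] :
    ∀ᶠ P : ℝ in atTop, ∀ H : EdgeCSI M K,
      Real.log P / cutoffRate (edgeMode P H).2.1 (edgeMode P H).2.2 ≤
        160 * (1 + sumInvGain H) := by
  -- The limits in the two large-grid modes are 1 and 2; the value 160 is dictated by the last mode.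
  have h1 : ∀ᶠ P : ℝ in atTop, Real.log P / cutoffRate 1 (gridSize P 1) < 160 :=
    (tendsto_log_div_cutoffRate one_pos).eventually_lt_const (by norm_num)
  have h2 : ∀ᶠ P : ℝ in atTop, Real.log P / cutoffRate 1 (gridSize P (1 / 2)) < 160 :=
    (tendsto_log_div_cutoffRate (r := 1 / 2) (by norm_num)).eventually_lt_const (by norm_num)
  filter_upwards [h1, h2, eventually_le_gridSize (r := 1 / 2) (by norm_num) 10,
    eventually_gt_atTop 1] with P h1 h2 h3 hP H
  have hΓ := sumInvGain_nonneg H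
  have hlog := Real.log_pos hP
  unfold edgeMode
  split_ifs with hzf hB
  · dsimp only
    linarith
  · dsimp only
    linarith
  · dsimp only
    -- The grid is large enough here, so this mode is entered only because the inverse gains are
    -- large. With `q ^ 2 * (1 + log P) ^ 2 ≤ √P` this forces `log P ≤ 2 * Γ`.
    have hB' : P < 2 * (gridSize P (1 / 2) : ℝ) ^ 2 * sumInvGain H := by
      by_contra hcon
      exact hB ⟨h3, not_lt.1 hcon⟩
    set Γ := sumInvGain H
    have hq : (gridSize P (1 / 2) : ℝ) ^ 2 * (1 + Real.log P) ^ 2 ≤ √P := by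
      have h4 := gridSize_le hP (1 / 2)
      rw [le_div_iff₀ (by linarith)] at h4
      calc _ = (gridSize P (1 / 2) * (1 + Real.log P)) ^ 2 := by ring
        _ ≤ (P ^ ((1 : ℝ) / 2 / 2)) ^ 2 := by gcongr
        _ = √P := by
          rw [← Real.rpow_natCast, ← Real.rpow_mul (by linarith), Real.sqrt_eq_rpow]
          norm_num
    have hs : 1 ≤ √P := Real.one_le_sqrt.2 hP.le
    have hss : √P * √P = P := Real.mul_self_sqrt (by linarith)
    have hlogΓ : Real.log P ≤ 2 * Γ := by
      have h5 : P * (1 + Real.log P) ^ 2 ≤ 2 * √P * Γ := by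
        have := mul_le_mul_of_nonneg_right hB'.le (sq_nonneg (1 + Real.log P))
        nlinarith
      have h6 : √P * (1 + Real.log P) ^ 2 ≤ 2 * Γ := by
        have : √P * (√P * (1 + Real.log P) ^ 2) ≤ √P * (2 * Γ) := by
          calc _ = P * (1 + Real.log P) ^ 2 := by rw [← mul_assoc, hss]
            _ ≤ _ := by linarith
        exact le_of_mul_le_mul_left this (by linarith)
      nlinarith [sq_nonneg (Real.log P)]
    set p : ℕ := ⌈√(2 * Γ / P)⌉₊ + 1
    have hp : (p : ℝ) ≤ √(2 * Γ / P) + 2 := by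
      have := (Nat.ceil_lt_add_one (Real.sqrt_nonneg (2 * Γ / P))).le
      push_cast [p]
      linarith
    have hp2 : (p : ℝ) ^ 2 ≤ 4 * Γ / P + 8 := by
      have h5 := Real.sq_sqrt (show 0 ≤ 2 * Γ / P by positivity)
      have h6 : (p : ℝ) ^ 2 ≤ (√(2 * Γ / P) + 2) ^ 2 := by gcongr
      have h7 : 4 * Γ / P = 2 * (2 * Γ / P) := by ring
      rw [h7]
      nlinarith [sq_nonneg (√(2 * Γ / P) - 2)]
    have hρ := le_cutoffRate_two_points (show 1 ≤ p by omega)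
    have hppos : (0 : ℝ) < p := by positivity
    rw [div_le_iff₀ (lt_of_lt_of_le (by positivity) hρ)]
    have hlP : Real.log P / P ≤ 1 := by
      rw [div_le_one (by linarith)]
      linarith [Real.log_le_sub_one_of_pos (show 0 < P by linarith)]
    -- Origin of 160: `8 log P * (4 Γ / P + 8) ≤ 32 Γ + 64 log P`, and `64 log P ≤ 128 Γ`.
    have h8 : Real.log P * (8 * (p : ℝ) ^ 2) ≤ 160 * (1 + Γ) := by
      have h9 : Real.log P * (4 * Γ / P) ≤ 4 * Γ := by
        calc _ = Real.log P / P * (4 * Γ) := by ring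
          _ ≤ 1 * (4 * Γ) := by gcongr
          _ = _ := one_mul _
      have h10 := mul_le_mul_of_nonneg_left hp2 hlog.le
      nlinarith
    calc Real.log P = Real.log P * (8 * (p : ℝ) ^ 2) * (1 / (8 * (p : ℝ) ^ 2)) := by
          field_simp
      _ ≤ 160 * (1 + Γ) * (1 / (8 * (p : ℝ) ^ 2)) := by gcongr
      _ ≤ _ := by gcongr

end FRAN

namespace FRAN

/-! ### Normalized delivery times of the scheme -/

variable {M K : ℕ}

lemma hasNDT_fronthaulTime [NeZero M] {r : ℝ} (hr : 0 < r) (G : FronthaulCSI M) :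
    HasNDT M (fun ℓ P => (fronthaulTime K ℓ r P G : ℝ≥0∞)) (K * (M - 1) / (M * r)) := by
  have hM : (M : ℝ) ≠ 0 := by exact_mod_cast NeZero.ne M
  refine ⟨fun P => ENNReal.ofReal ((1 : ℕ) * (K * (M - 1) : ℕ) / M * (Real.log P /
    cutoffRate (fronthaulMode r P G).1 (fronthaulMode r P G).2)), ?_, ?_⟩
  · filter_upwards [eventually_gt_atTop 1] with P hP
    have h := tendsto_blockLength_normalized (M := M) 1 (K * (M - 1))
      (cutoffRate_fronthaulMode_pos r P G) hP
    simpa only [fronthaulTime, ← mul_assoc, one_mul] using h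
  · refine ENNReal.tendsto_ofReal ?_
    have h := (tendsto_log_div_cutoffRate hr).const_mul ((1 : ℕ) * (K * (M - 1) : ℕ) / M : ℝ)
    have h2 : ((1 : ℕ) * (K * (M - 1) : ℕ) / M : ℝ) * (1 / r) = K * (M - 1) / (M * r) := by
      rw [Nat.cast_mul, Nat.cast_pred (NeZero.pos M)]
      push_cast
      field_simp
    rw [h2] at h
    refine h.congr' ?_
    filter_upwards [eventually_fronthaulMode_eq hr G] with P hP
    rw [hP]

/-- Normalized duration of the edge phase at power `P`. -/
noncomputable def edgeNDT [NeZero K] (P : ℝ) (H : EdgeCSI M K) : ℝ :=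
  K / numServed M K (edgeMode P H) *
    (Real.log P / cutoffRate (edgeMode P H).2.1 (edgeMode P H).2.2)

lemma tendsto_edgeTime_normalized [NeZero M] [NeZero K] {P : ℝ} (hP : 1 < P) (H : EdgeCSI M K) :
    Tendsto (fun ℓ : ℕ => ((K * numRounds M K ℓ (edgeMode P H) : ℕ) : ℝ≥0∞) /
      ENNReal.ofReal (((M * ℓ : ℕ) : ℝ) / Real.logb 2 P)) atTop
      (𝓝 (ENNReal.ofReal (edgeNDT P H))) := by
  have hM : (M : ℝ) ≠ 0 := by exact_mod_cast NeZero.ne M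
  have hs : (0 : ℝ) < numServed M K (edgeMode P H) := by exact_mod_cast numServed_pos _
  have h := tendsto_blockLength_normalized (M := M) K M
    (mul_pos hs (cutoffRate_edgeMode_pos P H)) hP
  have h2 : (K : ℝ) * M / M * (Real.log P / (numServed M K (edgeMode P H) *
      cutoffRate (edgeMode P H).2.1 (edgeMode P H).2.2)) = edgeNDT P H := by
    have hρ := cutoffRate_edgeMode_pos P H
    rw [edgeNDT]
    field_simp
  rw [h2] at h
  exact h

lemma tendsto_edgeNDT [NeZero M] [NeZero K] {H : EdgeCSI M K}
    (hH : ∀ τ : Fin K, (zfMatrix H τ).det ≠ 0) :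
    Tendsto (fun P => ENNReal.ofReal (edgeNDT P H)) atTop
      (𝓝 (ENNReal.ofReal (K / min (M : ℝ) K))) := by
  refine ENNReal.tendsto_ofReal ?_
  have h := (tendsto_log_div_cutoffRate one_pos).const_mul (K / min (M : ℝ) K)
  rw [div_one, mul_one] at h
  refine h.congr' ?_
  filter_upwards [eventually_edgeMode_eq hH] with P hP
  rw [edgeNDT, hP]
  simp [numServed]

lemma hasNDT_edgeTime [NeZero M] [NeZero K] {H : EdgeCSI M K}
    (hH : ∀ τ : Fin K, (zfMatrix H τ).det ≠ 0) :
    HasNDT M (fun ℓ P => ((K * numRounds M K ℓ (edgeMode P H) : ℕ) : ℝ≥0∞))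
      (K / min (M : ℝ) K) := by
  refine ⟨fun P => ENNReal.ofReal (edgeNDT P H), ?_, tendsto_edgeNDT hH⟩
  filter_upwards [eventually_gt_atTop 1] with P hP
  exact tendsto_edgeTime_normalized hP H

/-! ### Expected edge time by dominated convergence -/

section Expectation

variable (ν : Measure ℂ) [IsProbabilityMeasure ν]

lemma lintegral_sumInvGain_lt_top
    (hint : ∫⁻ h : Fin M → ℂ, (∑ m, ‖h m‖ₑ ^ 2)⁻¹ ∂(Measure.pi fun _ => ν) < ∞) :
    ∫⁻ H : EdgeCSI M K, ENNReal.ofReal (sumInvGain H) ∂(edgeLaw M K ν) < ∞ := by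
  have hmeas : Measurable fun h : Fin M → ℂ => (∑ m, ‖h m‖ₑ ^ 2)⁻¹ := by fun_prop
  have hmeas' : ∀ k, Measurable fun H : EdgeCSI M K => (∑ m, ‖H k m‖ₑ ^ 2)⁻¹ := fun k =>
    hmeas.comp (measurable_pi_apply k)
  calc _ ≤ ∫⁻ H : EdgeCSI M K, ∑ k, (∑ m, ‖H k m‖ₑ ^ 2)⁻¹ ∂(edgeLaw M K ν) := by
        refine lintegral_mono fun H => ?_
        rw [sumInvGain, ENNReal.ofReal_sum_of_nonneg fun k _ => inv_nonneg.2 (userGain_nonneg H k)]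
        -- Only an inequality: at zero gain the real inverse is 0 and the extended one is `∞`.
        refine Finset.sum_le_sum fun k _ => ENNReal.ofReal_inv_le.trans ?_
        rw [userGain, ENNReal.ofReal_sum_of_nonneg fun m _ => by positivity]
        simp_rw [ENNReal.ofReal_pow (norm_nonneg _), ofReal_norm]
        exact le_rfl
    _ = ∑ _k : Fin K, ∫⁻ h : Fin M → ℂ, (∑ m, ‖h m‖ₑ ^ 2)⁻¹ ∂(Measure.pi fun _ => ν) := by
        rw [lintegral_finsetSum _ fun k _ => hmeas' k]
        refine Finset.sum_congr rfl fun k _ => ?_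
        exact (measurePreserving_eval (fun _ : Fin K => Measure.pi fun _ : Fin M => ν)
          k).lintegral_comp hmeas
    _ < ∞ := by
        rw [Finset.sum_const, nsmul_eq_mul]
        exact ENNReal.mul_lt_top (ENNReal.natCast_lt_top _) hint

lemma lintegral_affine_sumInvGain_ne_top
    (hint : ∫⁻ h : Fin M → ℂ, (∑ m, ‖h m‖ₑ ^ 2)⁻¹ ∂(Measure.pi fun _ => ν) < ∞) {A : ℝ}
    (hA : 0 ≤ A) :
    ∫⁻ H : EdgeCSI M K, ENNReal.ofReal (A * (1 + sumInvGain H)) ∂(edgeLaw M K ν) ≠ ∞ := by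
  have h : ∀ H : EdgeCSI M K, ENNReal.ofReal (A * (1 + sumInvGain H)) =
      ENNReal.ofReal A * (1 + ENNReal.ofReal (sumInvGain H)) := by
    intro H
    rw [ENNReal.ofReal_mul hA, ENNReal.ofReal_add zero_le_one (sumInvGain_nonneg H),
      ENNReal.ofReal_one]
  have hmeas : Measurable fun H : EdgeCSI M K => 1 + ENNReal.ofReal (sumInvGain H) :=
    measurable_const.add measurable_sumInvGain.ennreal_ofReal
  simp_rw [h]
  rw [lintegral_const_mul _ hmeas,
    lintegral_add_left measurable_const, lintegral_const, measure_univ, mul_one]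
  exact ENNReal.mul_ne_top ENNReal.ofReal_ne_top
    (ENNReal.add_ne_top.2 ⟨ENNReal.one_ne_top, (lintegral_sumInvGain_lt_top ν hint).ne⟩)

/-- Dominated convergence is used twice, for `ℓ → ∞` at fixed `P` and then for `P → ∞`. Both
dominating functions are multiples of `1 + sumInvGain H`. Invertibility of the channel matrices is
needed only for the second limit. -/
lemma hasNDT_lintegral_edgeTime [NeZero M] [NeZero K] (hν : ∀ z : ℂ, ν {z} = 0)
    (hint : ∫⁻ h : Fin M → ℂ, (∑ m, ‖h m‖ₑ ^ 2)⁻¹ ∂(Measure.pi fun _ => ν) < ∞) :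
    HasNDT M (fun ℓ P => ∫⁻ H : EdgeCSI M K,
      ((K * numRounds M K ℓ (edgeMode P H) : ℕ) : ℝ≥0∞) ∂(edgeLaw M K ν))
      (K / min (M : ℝ) K) := by
  have hM : (0 : ℝ) < M := by exact_mod_cast NeZero.pos M
  refine ⟨fun P => ∫⁻ H, ENNReal.ofReal (edgeNDT P H) ∂(edgeLaw M K ν), ?_, ?_⟩
  · filter_upwards [eventually_log_div_cutoffRate_edgeMode_le (M := M) (K := K),
      eventually_gt_atTop 1] with P hbound hP
    have hlogb : 0 < Real.logb 2 P := Real.logb_pos (by norm_num) hP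
    have hmeas : ∀ ℓ, Measurable fun H : EdgeCSI M K =>
        ((K * numRounds M K ℓ (edgeMode P H) : ℕ) : ℝ≥0∞) := fun ℓ =>
      (measurable_of_countable fun e : EdgeMode => ((K * numRounds M K ℓ e : ℕ) : ℝ≥0∞)).comp
        (measurable_edgeMode P)
    simp_rw [ENNReal.div_eq_inv_mul, ← lintegral_const_mul _ (hmeas _), ← ENNReal.div_eq_inv_mul]
    set A : ℝ := K / M * ((M + 1) * 160 + Real.logb 2 P) with hA
    refine tendsto_lintegral_filter_of_dominated_convergence
      (fun H => ENNReal.ofReal (A * (1 + sumInvGain H)))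
      (Eventually.of_forall fun ℓ => (hmeas ℓ).div_const _) ?_
      (lintegral_affine_sumInvGain_ne_top ν hint (by positivity))
      (ae_of_all _ fun H => tendsto_edgeTime_normalized hP H)
    filter_upwards [eventually_ge_atTop 1] with ℓ hℓ
    refine ae_of_all _ fun H => ?_
    have hs : (1 : ℝ) ≤ numServed M K (edgeMode P H) := by exact_mod_cast numServed_pos _
    have hρ := cutoffRate_edgeMode_pos P H
    refine (blockLength_normalized_le (M := M) K M (mul_pos (by linarith) hρ) hP hℓ).trans
      (ENNReal.ofReal_le_ofReal ?_)
    rw [hA, mul_assoc]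
    have hlog := Real.log_pos hP
    have h1 : Real.log P / (numServed M K (edgeMode P H) *
        cutoffRate (edgeMode P H).2.1 (edgeMode P H).2.2) ≤ 160 * (1 + sumInvGain H) := by
      refine le_trans ?_ (hbound H)
      gcongr
      exact le_mul_of_one_le_left hρ.le hs
    have h2 := sumInvGain_nonneg H
    have h3 : Real.logb 2 P ≤ Real.logb 2 P * (1 + sumInvGain H) :=
      le_mul_of_one_le_right hlogb.le (by linarith)
    gcongr
    calc _ ≤ ((M : ℝ) + 1) * (160 * (1 + sumInvGain H)) + Real.logb 2 P * (1 + sumInvGain H) := by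
          gcongr
      _ = _ := by ring
  · have hlim : ∫⁻ _H : EdgeCSI M K, ENNReal.ofReal (K / min (M : ℝ) K) ∂(edgeLaw M K ν) =
        ENNReal.ofReal (K / min (M : ℝ) K) := by simp
    rw [← hlim]
    refine tendsto_lintegral_filter_of_dominated_convergence
      (fun H => ENNReal.ofReal (K * 160 * (1 + sumInvGain H)))
      (Eventually.of_forall fun P => ?_) ?_
      (lintegral_affine_sumInvGain_ne_top ν hint (by positivity)) ?_
    · exact (measurable_of_countable fun e : EdgeMode => ENNReal.ofReal
        (K / numServed M K e * (Real.log P / cutoffRate e.2.1 e.2.2))).comp (measurable_edgeMode P)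
    · filter_upwards [eventually_log_div_cutoffRate_edgeMode_le (M := M) (K := K),
        eventually_gt_atTop 1] with P hbound hP
      refine ae_of_all _ fun H => ENNReal.ofReal_le_ofReal ?_
      have hs : (1 : ℝ) ≤ numServed M K (edgeMode P H) := by exact_mod_cast numServed_pos _
      have hρ := cutoffRate_edgeMode_pos P H
      have hlog := Real.log_pos hP
      rw [edgeNDT, mul_assoc (K : ℝ)]
      exact mul_le_mul (div_le_self (Nat.cast_nonneg _) hs) (hbound H) (by positivity)
        (Nat.cast_nonneg _)
    · filter_upwards [ae_det_zfMatrix_ne_zero hν] with H hH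
      exact tendsto_edgeNDT hH

end Expectation

end FRAN

theorem lemma1 (M K N : ℕ) (hM : 1 ≤ M) (hK : 1 ≤ K) (r : ℝ) (hr : 0 < r)
    (ν : Measure ℂ) [IsProbabilityMeasure ν] (hν : ∀ z : ℂ, ν {z} = 0) :
    -- every edge node recovers all requested files from its own parts and the XORs
    (∀ (ℓ : ℕ) (F : FRAN.Library N (M * ℓ)) (d : FRAN.Demand K N) (m : Fin M) (k : Fin K),
      FRAN.recoverFile m (FRAN.subfile (F (d k)) m) (FRAN.codedMessage F d k) = F (d k)) ∧
    -- a coded multicasting scheme with zero forcing for every file size `M ℓ` and power `P`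
    ∃ σ : (ℓ : ℕ) → ℝ → FRAN.CodedMulticast M K N ℓ,
      (∀ P : ℝ, 1 < P → ∀ ℓ : ℕ,
        (σ ℓ P).IsZeroForcing ∧
        (σ ℓ P).toPolicy.IsMeasurable ∧
        (σ ℓ P).toPolicy.CacheConstraint (1 / M) ∧
        (σ ℓ P).toPolicy.PowerConstraint r P) ∧
      ∀ (d : FRAN.Demand K N) (G : FRAN.FronthaulCSI M), (∀ m, G m ≠ 0) →
        -- feasibility
        (∀ P : ℝ, 1 < P →
          Tendsto (fun ℓ => (σ ℓ P).enError ν d G) atTop (𝓝 0) ∧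
          Tendsto (fun ℓ => (σ ℓ P).toPolicy.errorProb ν d G) atTop (𝓝 0)) ∧
        -- fronthaul and edge NDT for almost every realization of the edge gains
        (∀ᵐ H ∂(FRAN.edgeLaw M K ν),
          FRAN.HasNDT M (fun ℓ P => ((σ ℓ P).TF d G H : ℝ≥0∞)) (K * (M - 1) / (M * r)) ∧
          FRAN.HasNDT M (fun ℓ P => ((σ ℓ P).TE d G H : ℝ≥0∞)) (K / min (M : ℝ) K)) ∧
        -- fronthaul NDT in expectation
        FRAN.HasNDT M (fun ℓ P => ∫⁻ H, ((σ ℓ P).TF d G H : ℝ≥0∞) ∂(FRAN.edgeLaw M K ν))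
          (K * (M - 1) / (M * r)) ∧
        -- edge NDT in expectation, if the mean inverse gain of a user is finite
        (∫⁻ h : Fin M → ℂ, (∑ m, ‖h m‖ₑ ^ 2)⁻¹ ∂(Measure.pi fun _ => ν) < ∞ →
          FRAN.HasNDT M (fun ℓ P => ∫⁻ H, ((σ ℓ P).TE d G H : ℝ≥0∞) ∂(FRAN.edgeLaw M K ν))
            (K / min (M : ℝ) K)) := by
  have : NeZero M := ⟨by omega⟩
  have : NeZero K := ⟨by omega⟩
  refine ⟨fun ℓ F d m k => FRAN.recoverFile_eq (F (d k)) m _ fun j => rfl,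
    FRAN.codedMulticastScheme M N r, fun P hP ℓ => ⟨?_, ?_, ?_, ?_⟩, fun d G hG => ⟨?_, ?_, ?_, ?_⟩⟩
  · exact FRAN.isZeroForcing_codedMulticastScheme M N r ℓ P
  · exact FRAN.isMeasurable_codedMulticastScheme M N r ℓ P
  · exact FRAN.cacheConstraint_codedMulticastScheme N r ℓ P
  · exact FRAN.powerConstraint_codedMulticastScheme M N r ℓ hP
  · exact fun P _ => ⟨FRAN.tendsto_enError ν r P d hG, FRAN.tendsto_errorProb ν hν r P d hG⟩
  · filter_upwards [FRAN.ae_det_zfMatrix_ne_zero hν] with H hH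
    exact ⟨FRAN.hasNDT_fronthaulTime hr G, FRAN.hasNDT_edgeTime hH⟩
  · have h : ∀ (ℓ : ℕ) (P : ℝ), ∫⁻ H : FRAN.EdgeCSI M K,
        ((FRAN.codedMulticastScheme (K := K) M N r ℓ P).TF d G H : ℝ≥0∞) ∂(FRAN.edgeLaw M K ν) =
        (FRAN.fronthaulTime K ℓ r P G : ℝ≥0∞) := by
      intro ℓ P
      simp [FRAN.codedMulticastScheme]
    simp_rw [h]
    exact FRAN.hasNDT_fronthaulTime hr G
  · exact fun hint => FRAN.hasNDT_lintegral_edgeTime ν hν hint
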